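/- **The filter category.** A filter is a pair $\mathcal F=(C,(\mathcal F_i)_{i\in I})$ of a set $C$ and a family of subsets of $C$ with $I$ inhabited such that for all $i,j\in I$ there is $k\in I$ with $\mathcal F_k\subseteq\mathcal F_i\cap\mathcal F_j$. A continuous map $(C,\mathcal F_I)\to(D,\mathcal G_J)$ is a function $\alpha:\mathcal F_i\to D$, for some $i\in I$, such that for every $j\in J$ there is $i'\in I$ with $\mathcal F_{i'}\subseteq\alpha^{-1}(\mathcal G_j)$. Two continuous maps are equivalent if they agree on some $\mathcal F_k$ contained in both domains. $\mathfrak F\mathbf{Set}$ is the category of filters and equivalence classes (germs) of continuous maps; a set $S$ is identified with the filter $(S,\{S\})$. The precanonical topology $K$ on $\mathfrak F\mathbf{Set}$ has as covers the finite families $\{\beta_k:\mathcal G_k\to\mathcal F\}_{k=1}^n$ such that for every choice of base sets $\mathcal G_{k,j_k}$ of $\mathcal G_k$ there is a base set $\mathcal F_i\subseteq\bigcup_k\beta_k(\mathcal G_{k,j_k})$. $K$ is subcanonical; let $\mathcal N=\mathrm{Sh}(\mathfrak F\mathbf{Set},K)$, let $\mathbf y$ be the Yoneda embedding, and let $\Delta:\mathbf{Set}\to\mathcal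 N$ be the constant sheaf functor. **The language.** Let $\mathcal L$ be a many-sorted first-order language with equality whose types include, for each type $S$, a type $S^*$, and which has a membership relation $x\in s$ for $x:S$, $s:S^*$. Fix an interpretation of $\mathcal L$ in $\mathbf{Set}$ in which $S^*$ is the set of finite sequences of elements of $S$, and $x\in s$ says that $x$ is an entry of $s$. Let $\mathcal L_{\mathrm{st}}$ be $\mathcal L$ with an additional unary predicate $\mathrm{st}_S$ for every type $S$. A formula is internal if it belongs to $\mathcal L$. Interpret $\mathcal L_{\mathrm{st}}$ in $\mathcal N$ by $[\![S]\!]=\mathbf yS$, $[\![f]\!]=\mathbf yf$, $[\![R]\!]=\mathbf yR$ for the types, function symbols (including constants) and relation symbols of $\mathcal L$, and $[\![\mathrm{st}_S]\!]=\Delta S$, a subobject of $\mathbf yS$ through the canonical map sending elements of $S$ to constant maps; truth in $\mathcal N$ is given by the usual (Kripke–Joyal) forcing semantics of sheaves. Write $$\forall^{\mathrm{st}}x:S\;\Phi(x):=\forall x:S\,(\mathrm{st}_S(x)\to\Phi(x)),\qquad \mathrm{hyper}(s):=\forall^{\mathrm{st}}x:S\;(x\in s)\quad(s:S^*).$$ **Proposition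 (sequence overspill $\mathsf{OS}^*$ holds in $\mathcal N$).** For every type $S$ and every internal formula $\varphi(\vec y,s)$ with $s:S^*$ and parameters $\vec y$ of arbitrary types, the formula $$\forall^{\mathrm{st}}s:S^*\;\varphi(\vec y,s)\;\to\;\exists s:S^*\,\bigl(\mathrm{hyper}(s)\wedge\varphi(\vec y,s)\bigr)$$ holds in $\mathcal N$, i.e. it is forced at every filter $\mathcal F$ for all values of $\vec y$ over $\mathcal F$. -/

import Mathlib

open CategoryTheory Opposite

universe u

/-- An object of the filter category over `Set`: a set together with an indexed filter base of
subsets, i.e. an inhabited family of subsets that is downwards directed. -/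
structure FilterSet : Type (u + 1) where
  carrier : Type u
  Idx : Type u
  base : Idx → Set carrier
  inhabited : Nonempty Idx
  directed : ∀ i j : Idx, ∃ k : Idx, base k ⊆ base i ∩ base j

namespace FilterSet

/-- The filter of subsets generated by the filter base. -/
def filter (F : FilterSet.{u}) : Filter F.carrier where
  sets := {A | ∃ i, F.base i ⊆ A}
  univ_sets := F.inhabited.elim fun i => ⟨i, Set.subset_univ _⟩
  sets_of_superset := fun ⟨i, hi⟩ h => ⟨i, hi.trans h⟩
  inter_sets := fun ⟨i, hi⟩ ⟨j, hj⟩ =>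
    (F.directed i j).elim fun k hk => ⟨k, hk.trans (Set.inter_subset_inter hi hj)⟩

theorem eventually_iff {F : FilterSet.{u}} {p : F.carrier → Prop} :
    (∀ᶠ x in F.filter, p x) ↔ ∃ i, ∀ x ∈ F.base i, p x := Iff.rfl

theorem eventually_base (F : FilterSet.{u}) (i : F.Idx) : ∀ᶠ x in F.filter, x ∈ F.base i :=
  ⟨i, fun _ h => h⟩

/-- A continuous partial map: a function defined on some base set of the source, such that the
inverse image of every base set of the target contains a base set of the source. -/
structure PartialMap (F G : FilterSet.{u}) : Type u where
  dom : F.Idx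
  toFun : F.base dom → G.carrier
  continuous : ∀ j : G.Idx, ∃ i : F.Idx,
    F.base i ⊆ {x | ∃ h : x ∈ F.base dom, toFun ⟨x, h⟩ ∈ G.base j}

namespace PartialMap

variable {F G H : FilterSet.{u}}

/-- `a.Graph x y`: the partial map `a` is defined at `x`, with value `y`. -/
def Graph (a : PartialMap F G) (x : F.carrier) (y : G.carrier) : Prop :=
  ∃ h : x ∈ F.base a.dom, a.toFun ⟨x, h⟩ = y

/-- Direct image of a subset under a partial map. -/
def image (a : PartialMap F G) (A : Set F.carrier) : Set G.carrier :=
  {y | ∃ x ∈ A, a.Graph x y}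

/-- Two continuous partial maps are equivalent if they are defined and agree on a common base
set. -/
def Equivalent (a b : PartialMap F G) : Prop :=
  ∃ (k : F.Idx) (ha : F.base k ⊆ F.base a.dom) (hb : F.base k ⊆ F.base b.dom),
    ∀ (x : F.carrier) (hx : x ∈ F.base k), a.toFun ⟨x, ha hx⟩ = b.toFun ⟨x, hb hx⟩

theorem Graph.unique {a : PartialMap F G} {x : F.carrier} {y y' : G.carrier}
    (h : a.Graph x y) (h' : a.Graph x y') : y = y' := by
  obtain ⟨_, rfl⟩ := h
  obtain ⟨_, rfl⟩ := h'
  rfl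

theorem eventually_mem (a : PartialMap F G) (j : G.Idx) :
    ∀ᶠ x in F.filter, ∃ y ∈ G.base j, a.Graph x y := by
  obtain ⟨i, hi⟩ := a.continuous j
  refine ⟨i, fun x hx => ?_⟩
  obtain ⟨h, h'⟩ := hi hx
  exact ⟨_, h', h, rfl⟩

theorem eventually_of {a : PartialMap F G} {p : G.carrier → Prop}
    (h : ∀ᶠ y in G.filter, p y) : ∀ᶠ x in F.filter, ∃ y, a.Graph x y ∧ p y := by
  obtain ⟨j, hj⟩ := h
  filter_upwards [a.eventually_mem j] with x ⟨y, hy, hxy⟩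
  exact ⟨y, hxy, hj hy⟩

theorem eventually_graph (a : PartialMap F G) : ∀ᶠ x in F.filter, ∃ y, a.Graph x y :=
  ⟨a.dom, fun _ h => ⟨_, h, rfl⟩⟩

theorem equivalent_iff {a b : PartialMap F G} :
    a.Equivalent b ↔ ∀ᶠ x in F.filter, ∃ y, a.Graph x y ∧ b.Graph x y := by
  constructor
  · rintro ⟨k, ha, hb, h⟩
    exact ⟨k, fun x hx => ⟨_, ⟨ha hx, rfl⟩, hb hx, (h x hx).symm⟩⟩
  · rintro ⟨k, hk⟩
    refine ⟨k, fun x hx => ?_, fun x hx => ?_, fun x hx => ?_⟩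
    · obtain ⟨y, ⟨h, _⟩, _⟩ := hk hx
      exact h
    · obtain ⟨y, _, ⟨h, _⟩⟩ := hk hx
      exact h
    · obtain ⟨y, ⟨_, h⟩, ⟨_, h'⟩⟩ := hk hx
      exact h.trans h'.symm

/-- The setoid whose classes are the germs of continuous partial maps. -/
instance setoid (F G : FilterSet.{u}) : Setoid (PartialMap F G) where
  r := Equivalent
  iseqv := by
    refine ⟨fun a => ?_, fun {a b} h => ?_, fun {a b c} h h' => ?_⟩
    · rw [equivalent_iff]
      filter_upwards [a.eventually_graph] with x ⟨y, hy⟩ using ⟨y, hy, hy⟩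
    · rw [equivalent_iff] at h ⊢
      filter_upwards [h] with x ⟨y, hy, hy'⟩ using ⟨y, hy', hy⟩
    · rw [equivalent_iff] at h h' ⊢
      filter_upwards [h, h'] with x ⟨y, hy, hy'⟩ ⟨z, hz, hz'⟩
      exact ⟨y, hy, hy'.unique hz ▸ hz'⟩

theorem eq_iff {a b : PartialMap F G} :
    (⟦a⟧ : Quotient (setoid F G)) = ⟦b⟧ ↔
      ∀ᶠ x in F.filter, ∃ y, a.Graph x y ∧ b.Graph x y :=
  Quotient.eq.trans equivalent_iff

/-- The continuous partial map given by a total continuous function. -/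
noncomputable def ofFun (f : F.carrier → G.carrier)
    (hf : ∀ j : G.Idx, ∃ i : F.Idx, ∀ x ∈ F.base i, f x ∈ G.base j) : PartialMap F G where
  dom := F.inhabited.some
  toFun x := f x
  continuous j := by
    obtain ⟨i, hi⟩ := hf j
    obtain ⟨k, hk⟩ := F.directed i F.inhabited.some
    exact ⟨k, fun x hx => ⟨(hk hx).2, hi x (hk hx).1⟩⟩

theorem ofFun_graph (f : F.carrier → G.carrier)
    (hf : ∀ j : G.Idx, ∃ i : F.Idx, ∀ x ∈ F.base i, f x ∈ G.base j) :
    ∀ᶠ x in F.filter, ((ofFun f hf).Graph x (f x)) :=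
  ⟨F.inhabited.some, fun _ hx => ⟨hx, rfl⟩⟩

theorem eq_of_ofFun_graph {f : F.carrier → G.carrier}
    {hf : ∀ j : G.Idx, ∃ i : F.Idx, ∀ x ∈ F.base i, f x ∈ G.base j} {x : F.carrier}
    {y : G.carrier} (h : (ofFun f hf).Graph x y) : f x = y := h.2

/-- The identity map. -/
noncomputable def id (F : FilterSet.{u}) : PartialMap F F :=
  ofFun (fun x => x) fun j => ⟨j, fun _ h => h⟩

/-- Composition of continuous partial maps: compose the functions on a base set that the first
map sends into the domain of the second one. -/
noncomputable def comp (a : PartialMap F G) (b : PartialMap G H) : PartialMap F H where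
  dom := (a.continuous b.dom).choose
  toFun x := b.toFun ⟨a.toFun ⟨x, ((a.continuous b.dom).choose_spec x.2).choose⟩,
    ((a.continuous b.dom).choose_spec x.2).choose_spec⟩
  continuous j := by
    obtain ⟨i, hi⟩ := b.continuous j
    obtain ⟨k, hk⟩ := a.continuous i
    obtain ⟨l, hl⟩ := F.directed k (a.continuous b.dom).choose
    refine ⟨l, fun x hx => ⟨(hl hx).2, ?_⟩⟩
    obtain ⟨_, h⟩ := hk (hl hx).1
    exact (hi h).choose_spec

theorem comp_graph {a : PartialMap F G} {b : PartialMap G H} {x : F.carrier} {z : H.carrier}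
    (h : (a.comp b).Graph x z) : ∃ y, a.Graph x y ∧ b.Graph y z := by
  obtain ⟨h, rfl⟩ := h
  exact ⟨_, ⟨_, rfl⟩, _, rfl⟩

theorem eventually_comp (a : PartialMap F G) (b : PartialMap G H) :
    ∀ᶠ x in F.filter, ∃ y z, a.Graph x y ∧ b.Graph y z ∧ (a.comp b).Graph x z := by
  filter_upwards [(a.comp b).eventually_graph] with x ⟨z, hz⟩
  obtain ⟨y, hy, hyz⟩ := comp_graph hz
  exact ⟨y, z, hy, hyz, hz⟩

theorem comp_congr {a a' : PartialMap F G} {b b' : PartialMap G H}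
    (h : a.Equivalent a') (h' : b.Equivalent b') : (a.comp b).Equivalent (a'.comp b') := by
  rw [equivalent_iff] at *
  filter_upwards [h, eventually_of (a := a) h', a.eventually_comp b, a'.eventually_comp b']
    with x ⟨y, hy, hy'⟩ ⟨y₁, hy₁, z₁, hz₁, hz₁'⟩ ⟨y₂, z₂, hy₂, hz₂, hc⟩ ⟨y₃, z₃, hy₃, hz₃, hc'⟩
  obtain rfl := hy.unique hy₁
  obtain rfl := hy.unique hy₂
  obtain rfl := hy'.unique hy₃
  obtain rfl := hz₁.unique hz₂
  obtain rfl := hz₁'.unique hz₃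
  exact ⟨z₁, hc, hc'⟩

theorem exists_ofRel (r : F.carrier → G.carrier → Prop)
    (hu : ∀ᶠ x in F.filter, ∀ y y', r x y → r x y' → y = y')
    (hc : ∀ j, ∀ᶠ x in F.filter, ∃ y ∈ G.base j, r x y) :
    ∃ a : PartialMap F G, ∀ᶠ x in F.filter, ∀ y, r x y → a.Graph x y := by
  obtain ⟨k, hk⟩ := hu.and (hc G.inhabited.some)
  have hex : ∀ x : F.base k, ∃ y, r x y := fun x => by
    obtain ⟨y, _, h⟩ := (hk x.2).2
    exact ⟨y, h⟩
  choose f hf using hex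
  refine ⟨⟨k, f, fun j => ?_⟩, k, fun x hx y hy => ⟨hx, (hk hx).1 _ _ (hf ⟨x, hx⟩) hy⟩⟩
  obtain ⟨i, hi⟩ := (hc j).and (F.eventually_base k)
  refine ⟨i, fun x hx => ⟨(hi hx).2, ?_⟩⟩
  obtain ⟨y, hy, hr⟩ := (hi hx).1
  rwa [(hk (hi hx).2).1 _ _ (hf ⟨x, (hi hx).2⟩) hr]

end PartialMap

open PartialMap

/-- The filter category over `Set`: morphisms are germs of continuous partial maps. -/
noncomputable instance category : Category.{u} FilterSet.{u} where
  Hom F G := Quotient (setoid F G)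
  id F := ⟦PartialMap.id F⟧
  comp := Quotient.map₂ comp fun _ _ h _ _ h' => comp_congr h h'
  id_comp := by
    rintro F G ⟨a⟩
    refine eq_iff.2 ?_
    filter_upwards [(PartialMap.id F).eventually_comp a] with x ⟨y, z, hy, hz, hc⟩
    exact ⟨z, hc, eq_of_ofFun_graph hy ▸ hz⟩
  comp_id := by
    rintro F G ⟨a⟩
    refine eq_iff.2 ?_
    filter_upwards [a.eventually_comp (PartialMap.id G)] with x ⟨y, z, hy, hz, hc⟩
    exact ⟨z, hc, eq_of_ofFun_graph hz ▸ hy⟩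
  assoc := by
    rintro F G H K ⟨a⟩ ⟨b⟩ ⟨c⟩
    refine eq_iff.2 ?_
    filter_upwards [(a.comp b).eventually_comp c, a.eventually_comp (b.comp c)]
      with x ⟨y, z, hy, hz, hc⟩ ⟨y', z', hy', hz', hc'⟩
    obtain ⟨w, hw, hwy⟩ := comp_graph hy
    obtain ⟨v, hv, hvz⟩ := comp_graph hz'
    obtain rfl := hw.unique hy'
    obtain rfl := hwy.unique hv
    obtain rfl := hz.unique hvz
    exact ⟨z, hc, hc'⟩

/-- The germ of a continuous partial map. -/
def germ {F G : FilterSet.{u}} (a : PartialMap F G) : F ⟶ G := Quotient.mk _ a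

theorem exists_germ {F G : FilterSet.{u}} (α : F ⟶ G) : ∃ a, germ a = α :=
  Quotient.exists_rep α

theorem germ_eq_iff {F G : FilterSet.{u}} {a b : PartialMap F G} :
    germ a = germ b ↔ ∀ᶠ x in F.filter, ∃ y, a.Graph x y ∧ b.Graph x y := eq_iff

theorem germ_comp {F G H : FilterSet.{u}} (a : PartialMap F G) (b : PartialMap G H) :
    germ a ≫ germ b = germ (a.comp b) := rfl

/-- A family of morphisms (only used for finite index types) covers `F` if, for every choice of base sets of the sources, the
union of their images contains a base set of `F`. -/
def IsCover {F : FilterSet.{u}} {ι : Type} (G : ι → FilterSet.{u}) (β : ∀ k, G k ⟶ F) : Prop :=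
  ∀ b : ∀ k, PartialMap (G k) F, (∀ k, germ (b k) = β k) →
    ∀ j : ∀ k, (G k).Idx, ∃ i : F.Idx, F.base i ⊆ ⋃ k, (b k).image ((G k).base (j k))

theorem isCover_germ_iff {F : FilterSet.{u}} {ι : Type} (G : ι → FilterSet.{u})
    (b : ∀ k, PartialMap (G k) F) :
    IsCover G (fun k => germ (b k)) ↔ ∀ p : ∀ k, (G k).carrier → Prop,
      (∀ k, ∀ᶠ x in (G k).filter, p k x) → ∀ᶠ y in F.filter, ∃ k x, p k x ∧ (b k).Graph x y := by
  constructor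
  · intro h p hp
    choose j hj using hp
    obtain ⟨i, hi⟩ := h b (fun _ => rfl) j
    refine ⟨i, fun y hy => ?_⟩
    obtain ⟨k, x, hx, hxy⟩ := Set.mem_iUnion.1 (hi hy)
    exact ⟨k, x, hj k hx, hxy⟩
  · intro h b' hb j
    have hb' := fun k => (germ_eq_iff.1 (hb k)).and ((G k).eventually_base (j k))
    obtain ⟨i, hi⟩ := h _ hb'
    refine ⟨i, fun y hy => Set.mem_iUnion.2 ?_⟩
    obtain ⟨k, x, ⟨⟨z, hz, hz'⟩, hx⟩, hxy⟩ := hi hy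
    exact ⟨k, x, hx, hz'.unique hxy ▸ hz⟩

/-- The pullback of two continuous partial maps. -/
def pullbackObj {F G H : FilterSet.{u}} (a : PartialMap F H) (b : PartialMap G H) :
    FilterSet.{u} where
  carrier := F.carrier × G.carrier
  Idx := F.Idx × G.Idx
  base i := {x | x.1 ∈ F.base i.1 ∧ x.2 ∈ G.base i.2 ∧ ∃ z, a.Graph x.1 z ∧ b.Graph x.2 z}
  inhabited := F.inhabited.elim fun i => G.inhabited.elim fun j => ⟨(i, j)⟩
  directed i j := by
    obtain ⟨k, hk⟩ := F.directed i.1 j.1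
    obtain ⟨l, hl⟩ := G.directed i.2 j.2
    exact ⟨(k, l), fun x hx => ⟨⟨(hk hx.1).1, (hl hx.2.1).1, hx.2.2⟩,
      (hk hx.1).2, (hl hx.2.1).2, hx.2.2⟩⟩

/-- The first projection of the pullback. -/
noncomputable def pullbackFst {F G H : FilterSet.{u}} (a : PartialMap F H)
    (b : PartialMap G H) : PartialMap (pullbackObj a b) F :=
  ofFun Prod.fst fun j => ⟨(j, G.inhabited.some), fun _ hx => hx.1⟩

/-- The second projection of the pullback. -/
noncomputable def pullbackSnd {F G H : FilterSet.{u}} (a : PartialMap F H)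
    (b : PartialMap G H) : PartialMap (pullbackObj a b) G :=
  ofFun Prod.snd fun j => ⟨(F.inhabited.some, j), fun _ hx => hx.2.1⟩

theorem pullback_condition {F G H : FilterSet.{u}} (a : PartialMap F H)
    (b : PartialMap G H) :
    germ (pullbackFst a b) ≫ germ a = germ (pullbackSnd a b) ≫ germ b := by
  rw [germ_comp, germ_comp, germ_eq_iff]
  have hb : ∀ᶠ x in (pullbackObj a b).filter, ∃ z, a.Graph x.1 z ∧ b.Graph x.2 z :=
    ⟨(F.inhabited.some, G.inhabited.some), fun _ hx => hx.2.2⟩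
  filter_upwards [(pullbackFst a b).eventually_comp a, (pullbackSnd a b).eventually_comp b, hb]
    with x ⟨y, z, hy, hz, hc⟩ ⟨y', z', hy', hz', hc'⟩ ⟨w, hw, hw'⟩
  obtain rfl := eq_of_ofFun_graph hy
  obtain rfl := eq_of_ofFun_graph hy'
  obtain rfl := hz.unique hw
  obtain rfl := hz'.unique hw'
  exact ⟨z', hc, hc'⟩

theorem IsCover.pullback {F H : FilterSet.{u}} {ι : Type} [Finite ι] {G : ι → FilterSet.{u}}
    {b : ∀ k, PartialMap (G k) F} (h : IsCover G fun k => germ (b k)) (a : PartialMap H F) :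
    IsCover (fun k => pullbackObj a (b k)) fun k => germ (pullbackFst a (b k)) := by
  rw [isCover_germ_iff] at h ⊢
  intro p hp
  have hp' := fun k => (hp k).and (ofFun_graph (F := pullbackObj a (b k)) (G := H) Prod.fst
    fun j => ⟨(j, (G k).inhabited.some), fun _ (hx : _ ∧ _) => hx.1⟩)
  choose i hi using hp'
  have h1 := h (fun k x => x ∈ (G k).base (i k).2) fun k => (G k).eventually_base _
  have h2 : ∀ᶠ x in H.filter, ∀ k, x ∈ H.base (i k).1 :=
    Filter.eventually_all.2 fun k => H.eventually_base _
  filter_upwards [eventually_of (a := a) h1, h2] with x ⟨z, hz, k, y, hy, hyz⟩ hx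
  have hm := hi k (show (x, y) ∈ (pullbackObj a (b k)).base (i k) from
    ⟨hx k, hy, z, hz, hyz⟩)
  exact ⟨k, (x, y), hm.1, hm.2⟩

theorem IsCover.exists_pullback {F H : FilterSet.{u}} {ι : Type} [Finite ι]
    {G : ι → FilterSet.{u}} {β : ∀ k, G k ⟶ F} (h : IsCover G β) (α : H ⟶ F) :
    ∃ (P : ι → FilterSet.{u}) (π : ∀ k, P k ⟶ H) (ρ : ∀ k, P k ⟶ G k),
      IsCover P π ∧ ∀ k, π k ≫ α = ρ k ≫ β k := by
  obtain ⟨a, rfl⟩ := exists_germ α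
  choose b hb using fun k => exists_germ (β k)
  obtain rfl : (fun k => germ (b k)) = β := funext hb
  exact ⟨_, _, fun k => germ (pullbackSnd a (b k)), h.pullback a,
    fun k => pullback_condition a (b k)⟩

theorem IsCover.trans {F : FilterSet.{u}} {ι : Type} {G : ι → FilterSet.{u}}
    {β : ∀ k, G k ⟶ F} (h : IsCover G β) {κ : ι → Type} {H : ∀ k, κ k → FilterSet.{u}}
    {γ : ∀ k l, H k l ⟶ G k} (h' : ∀ k, IsCover (H k) (γ k)) :
    IsCover (fun x : Σ k, κ k => H x.1 x.2) fun x => γ x.1 x.2 ≫ β x.1 := by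
  choose b hb using fun k => exists_germ (β k)
  choose c hc using fun k l => exists_germ (γ k l)
  obtain rfl : (fun k => germ (b k)) = β := funext hb
  obtain rfl : (fun k l => germ (c k l)) = γ := funext fun k => funext (hc k)
  change IsCover _ fun x : Σ k, κ k => germ ((c x.1 x.2).comp (b x.1))
  rw [isCover_germ_iff] at h ⊢
  intro p hp
  have h1 := fun k => (isCover_germ_iff _ _).1 (h' k)
    (fun l x => p ⟨k, l⟩ x ∧ ∃ y z, (c k l).Graph x y ∧ (b k).Graph y z ∧
      ((c k l).comp (b k)).Graph x z)
    fun l => (hp ⟨k, l⟩).and ((c k l).eventually_comp (b k))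
  filter_upwards [h _ h1] with z ⟨k, y, ⟨l, x, ⟨hx, y', z', hy', hz', hc⟩, hxy⟩, hyz⟩
  obtain rfl := hy'.unique hxy
  obtain rfl := hz'.unique hyz
  exact ⟨⟨k, l⟩, x, hx, hc⟩

theorem isCover_id (F : FilterSet.{u}) : IsCover (fun _ : Unit => F) fun _ => 𝟙 F := by
  refine (isCover_germ_iff (fun _ : Unit => F) fun _ => PartialMap.id F).2 fun p hp => ?_
  filter_upwards [hp (), (PartialMap.id F).eventually_graph] with x hx ⟨y, hy⟩
  refine ⟨(), x, hx, ?_⟩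
  have : x = y := eq_of_ofFun_graph hy
  exact this ▸ hy

/-- The precanonical topology: a sieve covers iff it contains a finite covering family. -/
def precanonicalTopology : GrothendieckTopology FilterSet.{u} where
  sieves F := {S | ∃ (ι : Type) (_ : Finite ι) (G : ι → FilterSet.{u}) (β : ∀ k, G k ⟶ F),
    IsCover G β ∧ ∀ k, S (β k)}
  top_mem' F := ⟨Unit, inferInstance, _, _, isCover_id F, fun _ => trivial⟩
  pullback_stable' := by
    rintro F H S f ⟨ι, _, G, β, h, hS⟩
    obtain ⟨P, π, ρ, hP, hc⟩ := h.exists_pullback f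
    refine ⟨ι, inferInstance, P, π, hP, fun k => ?_⟩
    change S (π k ≫ f)
    rw [hc]
    exact S.downward_closed (hS k) _
  transitive' := by
    rintro F S ⟨ι, _, G, β, h, hS⟩ R hR
    choose κ hκ H γ hγ hRγ using fun k => hR (hS k)
    exact ⟨_, inferInstance, _, _, h.trans hγ, fun x => hRγ x.1 x.2⟩

theorem IsCover.hom_ext {F K : FilterSet.{u}} {ι : Type} {G : ι → FilterSet.{u}}
    {β : ∀ k, G k ⟶ F} (h : IsCover G β) {s t : F ⟶ K} (hst : ∀ k, β k ≫ s = β k ≫ t) :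
    s = t := by
  choose b hb using fun k => exists_germ (β k)
  obtain rfl : (fun k => germ (b k)) = β := funext hb
  obtain ⟨s, rfl⟩ := exists_germ s
  obtain ⟨t, rfl⟩ := exists_germ t
  rw [germ_eq_iff]
  have h1 := (isCover_germ_iff _ _).1 h (fun k x => ∃ y z, (b k).Graph x y ∧
    s.Graph y z ∧ t.Graph y z) fun k => by
      filter_upwards [germ_eq_iff.1 (hst k)] with x ⟨z, hz, hz'⟩
      obtain ⟨y, hy, hyz⟩ := comp_graph hz
      obtain ⟨y', hy', hyz'⟩ := comp_graph hz'
      obtain rfl := hy.unique hy'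
      exact ⟨y, z, hy, hyz, hyz'⟩
  filter_upwards [h1] with y ⟨k, x, ⟨y', z, hy', hz⟩, hy⟩
  obtain rfl := hy'.unique hy
  exact ⟨z, hz⟩

theorem IsCover.exists_glue {F K : FilterSet.{u}} {ι : Type} [Finite ι] {G : ι → FilterSet.{u}}
    {β : ∀ k, G k ⟶ F} (h : IsCover G β) (x : ∀ k, G k ⟶ K)
    (hx : ∀ (k l : ι) (P : FilterSet.{u}) (f : P ⟶ G k) (g : P ⟶ G l),
      f ≫ β k = g ≫ β l → f ≫ x k = g ≫ x l) : ∃ t : F ⟶ K, ∀ k, β k ≫ t = x k := by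
  choose b hb using fun k => exists_germ (β k)
  choose c hc using fun k => exists_germ (x k)
  obtain rfl : (fun k => germ (b k)) = β := funext hb
  obtain rfl : (fun k => germ (c k)) = x := funext hc
  have hkl : ∀ k l, ∃ i : (G k).Idx × (G l).Idx, ∀ y ∈ (G k).base i.1, ∀ y' ∈ (G l).base i.2,
      ∀ z, (b k).Graph y z → (b l).Graph y' z → ∃ w, (c k).Graph y w ∧ (c l).Graph y' w := by
    intro k l
    have := hx k l _ _ _ (pullback_condition (b k) (b l))
    rw [germ_comp, germ_comp, germ_eq_iff] at this
    obtain ⟨i, hi⟩ := this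
    refine ⟨i, fun y hy y' hy' z hz hz' => ?_⟩
    obtain ⟨w, hw, hw'⟩ := hi (show (y, y') ∈ (pullbackObj (b k) (b l)).base i from
      ⟨hy, hy', z, hz, hz'⟩)
    obtain ⟨_, hv, hvw⟩ := comp_graph hw
    obtain ⟨_, hv', hvw'⟩ := comp_graph hw'
    obtain rfl := eq_of_ofFun_graph hv
    obtain rfl := eq_of_ofFun_graph hv'
    exact ⟨w, hvw, hvw'⟩
  choose i hi using hkl
  let U : ∀ k, (G k).carrier → Prop := fun k y =>
    ∀ l, y ∈ (G k).base (i k l).1 ∧ y ∈ (G k).base (i l k).2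
  have hU : ∀ k, ∀ᶠ y in (G k).filter, U k y := fun k =>
    Filter.eventually_all.2 fun l => ((G k).eventually_base _).and ((G k).eventually_base _)
  have hcov := (isCover_germ_iff _ _).1 h
  obtain ⟨t, ht⟩ := exists_ofRel (F := F) (G := K)
    (fun z w => ∃ k y, U k y ∧ (b k).Graph y z ∧ (c k).Graph y w)
    (Filter.Eventually.of_forall (by
      rintro z w w' ⟨k, y, hy, hyz, hyw⟩ ⟨l, y', hy', hyz', hyw'⟩
      obtain ⟨v, hv, hv'⟩ := hi k l y (hy l).1 y' (hy' k).2 z hyz hyz'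
      exact (hyw.unique hv).trans (hv'.unique hyw')))
    (fun j => by
      filter_upwards [hcov (fun k y => U k y ∧ ∃ w ∈ K.base j, (c k).Graph y w)
        fun k => (hU k).and ((c k).eventually_mem j)] with z ⟨k, y, ⟨hy, w, hw, hyw⟩, hyz⟩
      exact ⟨w, hw, k, y, hy, hyz, hyw⟩)
  refine ⟨germ t, fun k => ?_⟩
  rw [germ_comp, germ_eq_iff]
  filter_upwards [(b k).eventually_comp t, eventually_of (a := b k) ht, hU k,
    (c k).eventually_graph] with y ⟨z, w, hz, hw, hc⟩ ⟨z', hz', ht⟩ hy ⟨v, hv⟩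
  obtain rfl := hz.unique hz'
  obtain rfl := hw.unique (ht v ⟨k, y, hy, hz, hv⟩)
  exact ⟨w, hc, hv⟩

instance : precanonicalTopology.{u}.Subcanonical :=
  GrothendieckTopology.Subcanonical.of_isSheaf_yoneda_obj _ fun K F S hS x hx => by
    obtain ⟨ι, _, G, β, h, hSβ⟩ := hS
    obtain ⟨t, ht⟩ := h.exists_glue (fun k => x (β k) (hSβ k))
      fun k l P f g hfg => hx f g (hSβ k) (hSβ l) hfg
    refine ⟨t, fun H f hf => ?_, fun t' ht' => ?_⟩
    · obtain ⟨P, π, ρ, hP, hc⟩ := h.exists_pullback f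
      refine hP.hom_ext fun k => ?_
      change π k ≫ f ≫ t = π k ≫ x f hf
      rw [← Category.assoc, hc, Category.assoc, ht]
      exact (hx (π k) (ρ k) hf (hSβ k) (hc k)).symm
    · refine h.hom_ext fun k => ?_
      rw [ht]
      exact ht' (β k) (hSβ k)

/-- The simple filter `(S, {S})`. -/
def simpleObj (S : Type u) : FilterSet.{u} :=
  ⟨S, PUnit, fun _ => Set.univ, ⟨⟨⟩⟩, fun _ _ => ⟨⟨⟩, by simp⟩⟩

/-- A function, as a continuous map of simple filters. -/
noncomputable def simpleMap {S T : Type u} (f : S → T) :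
    PartialMap (simpleObj S) (simpleObj T) :=
  ofFun (F := simpleObj S) (G := simpleObj T) f fun _ => ⟨⟨⟩, fun _ _ => trivial⟩

theorem simpleMap_graph {S T : Type u} {f : S → T} {x : S} {z : T} :
    (simpleMap f).Graph x z ↔ f x = z :=
  ⟨fun h => eq_of_ofFun_graph h, fun h => ⟨trivial, h⟩⟩

/-- The embedding of `Set` into the filter category. -/
noncomputable def simple : Type u ⥤ FilterSet.{u} where
  obj S := simpleObj S
  map f := germ (simpleMap f)
  map_id S := rfl
  map_comp {S T U} f g := by
    rw [germ_comp, germ_eq_iff]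
    filter_upwards [(simpleMap f).eventually_comp (simpleMap g)] with x ⟨y, z, hy, hz, hc⟩
    refine ⟨z, simpleMap_graph.2 ?_, hc⟩
    obtain rfl := simpleMap_graph.1 hy
    exact simpleMap_graph.1 hz

/-- The constant morphism from `F` to the simple filter of `S` with value `x`. -/
noncomputable def const (F : FilterSet.{u}) {S : Type u} (x : S) : F ⟶ simple.obj S :=
  germ (ofFun (G := simpleObj S) (fun _ => x) fun _ => ⟨F.inhabited.some, fun _ _ => trivial⟩)

theorem comp_const {F G : FilterSet.{u}} (α : F ⟶ G) {S : Type u} (x : S) :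
    α ≫ const G x = const F x := by
  obtain ⟨a, rfl⟩ := exists_germ α
  refine (germ_comp _ _).trans (germ_eq_iff.2 ?_)
  filter_upwards [eventually_comp a (ofFun (G := simpleObj S) (fun _ => x)
      fun _ => ⟨G.inhabited.some, fun _ _ => trivial⟩),
    ofFun_graph (F := F) (G := simpleObj S) (fun _ => x)
      fun _ => ⟨F.inhabited.some, fun _ _ => trivial⟩] with u ⟨y, z, hy, hz, hc⟩ hx
  obtain rfl := eq_of_ofFun_graph hz
  exact ⟨_, hc, hx⟩

theorem germ_comp_map_eq_iff {F : FilterSet.{u}} {S T : Type u} (f : S ⟶ T)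
    {a : PartialMap F (simple.obj S)} {b : PartialMap F (simple.obj T)} :
    germ a ≫ simple.map f = germ b ↔
      ∀ᶠ u in F.filter, ∃ x : S, a.Graph u x ∧ b.Graph u (f x) := by
  refine (germ_eq_iff (a := a.comp (simpleMap f)) (b := b)).trans ?_
  constructor
  · intro h
    filter_upwards [h] with u ⟨z, hz, hz'⟩
    obtain ⟨x, hx, hxz⟩ := comp_graph hz
    obtain rfl := simpleMap_graph.1 hxz
    exact ⟨x, hx, hz'⟩
  · intro h
    filter_upwards [h, eventually_comp a (simpleMap f)] with u ⟨x, hx, hy⟩ ⟨x', z, hx', hz, hc⟩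
    obtain rfl := hx.unique hx'
    obtain rfl := simpleMap_graph.1 hz
    exact ⟨_, hc, hy⟩

theorem germ_comp_map_eq_comp_map_iff {F : FilterSet.{u}} {S S' T : Type u} (f : S ⟶ T)
    (g : S' ⟶ T) {a : PartialMap F (simple.obj S)} {b : PartialMap F (simple.obj S')} :
    germ a ≫ simple.map f = germ b ≫ simple.map g ↔
      ∀ᶠ u in F.filter, ∃ (x : S) (x' : S'), a.Graph u x ∧ b.Graph u x' ∧ f x = g x' := by
  refine (germ_comp_map_eq_iff f (b := b.comp (simpleMap g))).trans ?_
  constructor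
  · intro h
    filter_upwards [h] with u ⟨x, hx, hz⟩
    obtain ⟨x', hx', hxz⟩ := comp_graph hz
    exact ⟨x, x', hx, hx', (simpleMap_graph.1 hxz).symm⟩
  · intro h
    filter_upwards [h, eventually_comp b (simpleMap g)]
      with u ⟨x, x', hx, hx', hf⟩ ⟨x'', z, hx'', hz, hc⟩
    obtain rfl := hx'.unique hx''
    obtain rfl := simpleMap_graph.1 hz
    exact ⟨x, hx, hf ▸ hc⟩

theorem exists_tuple {F : FilterSet.{u}} {n : ℕ} {S : Fin n → Type u}
    (α : ∀ i, F ⟶ simple.obj (S i)) :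
    ∃! γ : F ⟶ simple.obj (∀ i, S i), ∀ i, γ ≫ simple.map (↾fun x => x i) = α i := by
  choose a ha using fun i => exists_germ (α i)
  obtain rfl : (fun i => germ (a i)) = α := funext ha
  have hall : ∀ᶠ u in F.filter, ∀ i, ∃ x, (a i).Graph u x :=
    Filter.eventually_all.2 fun i => (a i).eventually_graph
  obtain ⟨c, hc⟩ := exists_ofRel (F := F) (G := simple.obj (∀ i, S i))
    (fun u x => ∀ i, (a i).Graph u (x i))
    (Filter.Eventually.of_forall fun u x y hx hy => funext fun i => (hx i).unique (hy i))
    (fun _ => by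
      filter_upwards [hall] with u hu
      choose x hx using hu
      exact ⟨x, trivial, hx⟩)
  refine ⟨germ c, fun i => germ_comp_map_eq_iff _ |>.2 ?_, fun γ hγ => ?_⟩
  · filter_upwards [hall, hc] with u hu hc
    choose x hx using hu
    exact ⟨x, hc x hx, hx i⟩
  · obtain ⟨d, rfl⟩ := exists_germ γ
    rw [germ_eq_iff]
    have h := Filter.eventually_all.2 fun i => (germ_comp_map_eq_iff _).1 (hγ i)
    filter_upwards [h, hc, d.eventually_graph] with u hu hc ⟨y, hy⟩
    refine ⟨y, hy, hc y fun i => ?_⟩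
    obtain ⟨y', hy', hz⟩ := hu i
    obtain rfl := hy.unique hy'
    exact hz

/-- The morphism into a product of simple filters with given components. -/
noncomputable def tuple {F : FilterSet.{u}} {n : ℕ} {S : Fin n → Type u}
    (α : ∀ i, F ⟶ simple.obj (S i)) : F ⟶ simple.obj (∀ i, S i) :=
  (exists_tuple α).choose

theorem tuple_proj {F : FilterSet.{u}} {n : ℕ} {S : Fin n → Type u}
    (α : ∀ i, F ⟶ simple.obj (S i)) (i : Fin n) :
    tuple α ≫ simple.map (↾fun x => x i) = α i :=
  (exists_tuple α).choose_spec.1 i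

theorem tuple_ext {F : FilterSet.{u}} {n : ℕ} {S : Fin n → Type u}
    {γ δ : F ⟶ simple.obj (∀ i, S i)}
    (h : ∀ i, γ ≫ simple.map (↾fun x => x i) = δ ≫ simple.map (↾fun x => x i)) : γ = δ :=
  (exists_tuple _).unique h fun _ => rfl

/-- The topos of sheaves on filters. The site is a category with a large set of objects, so
sheaves take values in the next universe, over which the site is small. -/
abbrev NonstandardTopos : Type (u + 2) :=
  Sheaf precanonicalTopology.{u} (Type (u + 1))

/-- The Yoneda embedding, restricted to simple filters: the object `yS` of the topos. -/
noncomputable def y : Type u ⥤ NonstandardTopos.{u} :=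
  simple ⋙ GrothendieckTopology.uliftYoneda.{u + 1} precanonicalTopology.{u}

/-- The constant sheaf `ΔS`. -/
noncomputable def Δ (S : Type u) : NonstandardTopos.{u} :=
  (constantSheaf precanonicalTopology.{u} (Type (u + 1))).obj (ULift.{u + 1} S)

/-- The map of presheaves from the constant presheaf `S` to `yS` given by constant morphisms. -/
noncomputable def constToY (S : Type u) :
    (Functor.const FilterSet.{u}ᵒᵖ).obj (ULift.{u + 1} S) ⟶ (y.obj S).obj where
  app F := ↾fun x => ULift.up (const F.unop x.down)
  naturality F G f := by
    ext x
    exact congrArg ULift.up (comp_const f.unop x.down).symm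

/-- The canonical morphism from the constant sheaf `ΔS` to `yS`: the morphism out of the
sheafification that extends `constToY S`. -/
noncomputable def ΔToY (S : Type u) : Δ S ⟶ y.obj S :=
  ((sheafificationAdjunction precanonicalTopology.{u} (Type (u + 1))).homEquiv _ _).symm
    (constToY S)

instance (S : Type u) : Presheaf.IsLocallyInjective precanonicalTopology.{u} (constToY S) where
  equalizerSieve_mem {F} x x' h := by
    by_cases hx : x = x'
    · subst hx
      rw [Presheaf.equalizerSieve_self_eq_top]
      exact GrothendieckTopology.top_mem _ _
    · refine ⟨Empty, inferInstance, Empty.elim, fun k => k.elim, fun b hb j => ?_, fun k => k.elim⟩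
      obtain ⟨i, hi⟩ := germ_eq_iff.1 (congrArg ULift.down h)
      refine ⟨i, fun u hu => (hx ?_).elim⟩
      obtain ⟨z, hz, hz'⟩ := hi hu
      exact ULift.ext _ _ ((eq_of_ofFun_graph hz).trans (eq_of_ofFun_graph hz').symm)

instance (S : Type u) : Mono (ΔToY S) := by
  rw [ΔToY, Adjunction.homEquiv_counit]
  have : Mono ((presheafToSheaf precanonicalTopology.{u} (Type (u + 1))).map (constToY S)) := by
    have := (Presheaf.isLocallyInjective_presheafToSheaf_map_iff precanonicalTopology.{u}
      (constToY S)).2 inferInstance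
    exact Sheaf.mono_of_isLocallyInjective _
  exact @mono_comp _ _ _ _ _ _ this _ inferInstance

end FilterSet

universe a v w

/-- A many-sorted first order language, with a type `star σ` of finite sequences of elements of
`σ` for every type `σ`. Constants are function symbols of arity `0`. -/
structure SeqLanguage where
  Ty : Type a
  star : Ty → Ty
  Fn : Type a
  fnArity : Fn → ℕ
  fnDom : ∀ f, Fin (fnArity f) → Ty
  fnCod : Fn → Ty
  Rel : Type a
  relArity : Rel → ℕ
  relDom : ∀ r, Fin (relArity r) → Ty

/-- An interpretation of the language in `Set`: the type `star σ` is interpreted as the set of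
finite sequences of elements of the interpretation of `σ`. -/
structure SeqLanguage.SetStructure (L : SeqLanguage.{a}) where
  sort : L.Ty → Type u
  seqEquiv : ∀ σ, sort (L.star σ) ≃ List (sort σ)
  fn : ∀ f, (∀ i, sort (L.fnDom f i)) → sort (L.fnCod f)
  rel : ∀ r, Set (∀ i, sort (L.relDom r i))

namespace SeqLanguage

/-- Variables of type `σ` in a context, i.e. in a list of types. -/
inductive Var {T : Type a} : List T → T → Type a
  | zero {Γ σ} : Var (σ :: Γ) σ
  | succ {Γ σ τ} : Var Γ σ → Var (τ :: Γ) σ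

variable {L : SeqLanguage.{a}}

variable (L) in
/-- Terms in context. -/
inductive Term (Γ : List L.Ty) : L.Ty → Type a
  | var {σ} : Var Γ σ → Term Γ σ
  | app (f : L.Fn) : (∀ i, Term Γ (L.fnDom f i)) → Term Γ (L.fnCod f)

/-- Renaming of the variables of a term. -/
def Term.rename {Γ Δ : List L.Ty} (r : ∀ τ, Var Γ τ → Var Δ τ) :
    ∀ {σ}, L.Term Γ σ → L.Term Δ σ
  | _, .var x => .var (r _ x)
  | _, .app f ts => .app f fun i => (ts i).rename r

/-- A term, seen in a context with one more variable. -/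
def Term.weaken {Γ : List L.Ty} {σ τ : L.Ty} (t : L.Term Γ σ) : L.Term (τ :: Γ) σ :=
  t.rename fun _ => Var.succ

variable (L) in
/-- Formulae in context of the language extended with a standardness predicate for each type. -/
inductive Formula : List L.Ty → Type a
  | falsum {Γ} : Formula Γ
  | eq {Γ} {σ} : L.Term Γ σ → L.Term Γ σ → Formula Γ
  | rel {Γ} (r : L.Rel) : (∀ i, L.Term Γ (L.relDom r i)) → Formula Γ
  | mem {Γ} {σ} : L.Term Γ σ → L.Term Γ (L.star σ) → Formula Γ
  | st {Γ} {σ} : L.Term Γ σ → Formula Γ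
  | and {Γ} : Formula Γ → Formula Γ → Formula Γ
  | or {Γ} : Formula Γ → Formula Γ → Formula Γ
  | imp {Γ} : Formula Γ → Formula Γ → Formula Γ
  | all {Γ} (σ : L.Ty) : Formula (σ :: Γ) → Formula Γ
  | ex {Γ} (σ : L.Ty) : Formula (σ :: Γ) → Formula Γ

namespace Formula

/-- A formula is internal if the standardness predicates do not occur in it. -/
def IsInternal : ∀ {Γ : List L.Ty}, L.Formula Γ → Prop
  | _, falsum => True
  | _, eq _ _ => True
  | _, rel _ _ => True
  | _, mem _ _ => True
  | _, st _ => False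
  | _, and φ ψ => φ.IsInternal ∧ ψ.IsInternal
  | _, or φ ψ => φ.IsInternal ∧ ψ.IsInternal
  | _, imp φ ψ => φ.IsInternal ∧ ψ.IsInternal
  | _, all _ φ => φ.IsInternal
  | _, ex _ φ => φ.IsInternal

/-- `∀ x : σ, st x → Φ x`. -/
def allSt {Γ : List L.Ty} (σ : L.Ty) (Φ : L.Formula (σ :: Γ)) : L.Formula Γ :=
  all σ (imp (st (.var .zero)) Φ)

/-- `hyper s`: every standard `x : σ` occurs in `s`. -/
def hyper {Γ : List L.Ty} {σ : L.Ty} (s : L.Term Γ (L.star σ)) : L.Formula Γ :=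
  allSt σ (mem (.var .zero) s.weaken)

/-- `∃ s : σ*, hyper s ∧ Φ s`. -/
def exHyp {Γ : List L.Ty} (σ : L.Ty) (Φ : L.Formula (L.star σ :: Γ)) : L.Formula Γ :=
  ex (L.star σ) (and (hyper (.var .zero)) Φ)

/-- Sequence overspill for the formula `φ`. -/
def sequenceOverspill {Γ : List L.Ty} (σ : L.Ty) (φ : L.Formula (L.star σ :: Γ)) : L.Formula Γ :=
  imp (allSt (L.star σ) φ) (exHyp σ φ)

end Formula

section Sheaf

variable {C : Type v} [Category.{w} C]

/-- The product of a finite family of presheaves of sets. -/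
def piPresheaf {n : ℕ} (A : Fin n → Cᵒᵖ ⥤ Type u) : Cᵒᵖ ⥤ Type u where
  obj U := ∀ i, (A i).obj U
  map f := ↾fun x i => (A i).map f (x i)

/-- The morphism to a product with given components. -/
def piPresheafLift {n : ℕ} {A : Fin n → Cᵒᵖ ⥤ Type u} {P : Cᵒᵖ ⥤ Type u} (f : ∀ i, P ⟶ A i) :
    P ⟶ piPresheaf A where
  app U := ↾fun x i => (f i).app U x
  naturality U V g := by
    ext x
    funext i
    exact (f i).naturality_apply g x

variable (J : GrothendieckTopology C)

variable (L) in
/-- An interpretation of the language with standardness predicates in a category of sheaves: types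
are objects, function symbols are morphisms, relation symbols are subobjects. -/
structure SheafStructure where
  sort : L.Ty → Sheaf J (Type u)
  fn : ∀ f, piPresheaf (fun i => (sort (L.fnDom f i)).obj) ⟶ (sort (L.fnCod f)).obj
  rel : L.Rel → Sheaf J (Type u)
  relHom : ∀ r, (rel r).obj ⟶ piPresheaf fun i => (sort (L.relDom r i)).obj
  relMono : ∀ r, Mono (relHom r)
  mem : L.Ty → Sheaf J (Type u)
  memHom : ∀ σ, (mem σ).obj ⟶ FunctorToTypes.prod (sort σ).obj (sort (L.star σ)).obj
  memMono : ∀ σ, Mono (memHom σ)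
  st : L.Ty → Sheaf J (Type u)
  stHom : ∀ σ, (st σ).obj ⟶ (sort σ).obj
  stMono : ∀ σ, Mono (stHom σ)

namespace SheafStructure

variable {J} (A : SheafStructure.{u} L J)

/-- Assignments of sections over `U` to the variables of a context. -/
def Env (Γ : List L.Ty) (U : C) : Type (max a u) :=
  ∀ σ, Var Γ σ → (A.sort σ).obj.obj (op U)

variable {A}

/-- Restriction of an assignment along a morphism. -/
def Env.restrict {Γ : List L.Ty} {U V : C} (ρ : A.Env Γ U) (f : V ⟶ U) : A.Env Γ V :=
  fun σ x => (A.sort σ).obj.map f.op (ρ σ x)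

/-- Extension of an assignment to a context with one more variable. -/
def Env.cons {Γ : List L.Ty} {τ : L.Ty} {U : C} (x : (A.sort τ).obj.obj (op U))
    (ρ : A.Env Γ U) : A.Env (τ :: Γ) U
  | _, .zero => x
  | _, .succ z => ρ _ z

/-- The interpretation of terms. -/
def eval {Γ : List L.Ty} {U : C} (ρ : A.Env Γ U) :
    ∀ {σ}, L.Term Γ σ → (A.sort σ).obj.obj (op U)
  | _, .var x => ρ _ x
  | _, .app f ts => (A.fn f).app (op U) fun i => eval ρ (ts i)

/-- The forcing relation (Kripke-Joyal semantics) of the category of sheaves. -/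
def Forces : ∀ {Γ : List L.Ty}, L.Formula Γ → ∀ U : C, A.Env Γ U → Prop
  | _, .falsum, U, _ => ⊥ ∈ J U
  | _, .eq t s, _, ρ => eval ρ t = eval ρ s
  | _, .rel r ts, U, ρ => ∃ x, (A.relHom r).app (op U) x = fun i => eval ρ (ts i)
  | _, .mem (σ := σ) t s, U, ρ => ∃ x, (A.memHom σ).app (op U) x = (eval ρ t, eval ρ s)
  | _, .st (σ := σ) t, U, ρ => ∃ x, (A.stHom σ).app (op U) x = eval ρ t
  | _, .and φ ψ, U, ρ => Forces φ U ρ ∧ Forces ψ U ρ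
  | _, .or φ ψ, U, ρ => ∃ S ∈ J U, ∀ (V : C) (f : V ⟶ U), S f →
      Forces φ V (ρ.restrict f) ∨ Forces ψ V (ρ.restrict f)
  | _, .imp φ ψ, U, ρ => ∀ (V : C) (f : V ⟶ U),
      Forces φ V (ρ.restrict f) → Forces ψ V (ρ.restrict f)
  | _, .all _ φ, U, ρ => ∀ (V : C) (f : V ⟶ U) (x : _), Forces φ V ((ρ.restrict f).cons x)
  | _, .ex _ φ, U, ρ => ∃ S ∈ J U, ∀ (V : C) (f : V ⟶ U), S f →
      ∃ x, Forces φ V ((ρ.restrict f).cons x)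

variable (A)

/-- A formula holds in the category of sheaves if it is forced at every stage, for all values of
its free variables. -/
def Holds {Γ : List L.Ty} (φ : L.Formula Γ) : Prop :=
  ∀ (U : C) (ρ : A.Env Γ U), Forces φ U ρ

end SheafStructure

end Sheaf

open FilterSet

theorem mono_of_injective {C : Type v} [Category.{w} C] {P Q : C ⥤ Type u} (f : P ⟶ Q)
    (h : ∀ U x x', f.app U x = f.app U x' → x = x') : Mono f := by
  have := fun U => (mono_iff_injective (f.app U)).2 fun x x' => h U x x'
  exact NatTrans.mono_of_mono_app f

/-- The morphism `∏ y (S i) ≅ y (∏ S i) → y T` given by a function `∏ S i → T`. -/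
noncomputable def yFn {n : ℕ} {S : Fin n → Type u} {T : Type u} (f : (∀ i, S i) → T) :
    piPresheaf (fun i => (y.obj (S i)).obj) ⟶ (y.obj T).obj where
  app F := ↾fun α => ULift.up (tuple (fun i => (α i).down) ≫ simple.map (↾f))
  naturality F G g := by
    ext α
    refine congrArg ULift.up ((congrArg (· ≫ simple.map (↾f)) ?_).trans (Category.assoc _ _ _))
    refine tuple_ext fun i => ?_
    rw [tuple_proj, Category.assoc, tuple_proj]
    rfl

theorem simple_map_injective {F : FilterSet.{u}} {S T : Type u} {f : S ⟶ T}
    (hf : Function.Injective f) {α β : F ⟶ simple.obj S}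
    (h : α ≫ simple.map f = β ≫ simple.map f) : α = β := by
  obtain ⟨a, rfl⟩ := exists_germ α
  obtain ⟨b, rfl⟩ := exists_germ β
  rw [germ_comp_map_eq_comp_map_iff] at h
  rw [germ_eq_iff]
  filter_upwards [h] with u ⟨x, x', hx, hx', h⟩
  exact ⟨x, hx, hf h ▸ hx'⟩

/-- The morphism from `yR` to a product of the `y (S i)` given by a family of functions. -/
noncomputable def yRel {n : ℕ} {S : Fin n → Type u} {R : Type u} (p : ∀ i, R → S i) :
    (y.obj R).obj ⟶ piPresheaf fun i => (y.obj (S i)).obj :=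
  piPresheafLift fun i => (y.map (↾(p i))).hom

theorem yRel_mono {n : ℕ} {S : Fin n → Type u} (R : Set (∀ i, S i)) :
    Mono (yRel fun i (x : R) => x.1 i) := by
  refine mono_of_injective _ fun F α β h => ULift.ext _ _ ?_
  refine simple_map_injective (f := ↾fun x : R => x.1) (fun x x' h => Subtype.ext h) ?_
  refine tuple_ext fun i => ?_
  simp only [Category.assoc, ← simple.map_comp]
  exact congrArg ULift.down (congrFun h i)

/-- The morphism from `yR` to the product of `yS` and `yT` given by two functions. -/
noncomputable def yRel₂ {R S T : Type u} (p : R → S) (q : R → T) :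
    (y.obj R).obj ⟶ FunctorToTypes.prod (y.obj S).obj (y.obj T).obj :=
  FunctorToTypes.prod.lift (y.map (↾p)).hom (y.map (↾q)).hom

theorem yRel₂_mono {S T : Type u} (R : Set (S × T)) :
    Mono (yRel₂ (fun x : R => x.1.1) (fun x : R => x.1.2)) := by
  refine mono_of_injective _ fun F α β h => ULift.ext _ _ ?_
  have h1 := congrArg ULift.down (congrArg Prod.fst h)
  have h2 := congrArg ULift.down (congrArg Prod.snd h)
  obtain ⟨a, ha⟩ := exists_germ α.down
  obtain ⟨b, hb⟩ := exists_germ β.down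
  change α.down ≫ simple.map (↾fun x : R => x.1.1) = β.down ≫ _ at h1
  change α.down ≫ simple.map (↾fun x : R => x.1.2) = β.down ≫ _ at h2
  rw [← ha, ← hb] at h1 h2 ⊢
  rw [germ_comp_map_eq_comp_map_iff] at h1 h2
  rw [germ_eq_iff]
  filter_upwards [h1, h2] with u ⟨x, x', hx, hx', h⟩ ⟨z, z', hz, hz', h'⟩
  obtain rfl := hx.unique hz
  obtain rfl := hx'.unique hz'
  obtain rfl : x = x' := Subtype.ext (Prod.ext h h')
  exact ⟨x, hx, hx'⟩

/-- The interpretation of the language in the topos of sheaves on filters: types, function symbols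
and relation symbols are interpreted by the Yoneda embedding, and standardness by the constant
sheaf. -/
noncomputable def SetStructure.nonstandard {L : SeqLanguage.{a}} (M : SetStructure.{u} L) :
    SheafStructure.{u + 1} L precanonicalTopology.{u} where
  sort σ := y.obj (M.sort σ)
  fn f := yFn (M.fn f)
  rel r := y.obj (M.rel r)
  relHom _ := yRel fun i x => x.1 i
  relMono r := yRel_mono (M.rel r)
  mem σ := y.obj {p : M.sort σ × M.sort (L.star σ) // p.1 ∈ M.seqEquiv σ p.2}
  memHom _ := yRel₂ (fun p => p.1.1) fun p => p.1.2
  memMono σ := yRel₂_mono {p : M.sort σ × M.sort (L.star σ) | p.1 ∈ M.seqEquiv σ p.2}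
  st σ := Δ (M.sort σ)
  stHom σ := (ΔToY (M.sort σ)).hom
  stMono σ := inferInstanceAs (Mono ((sheafToPresheaf _ _).map (ΔToY (M.sort σ))))

end SeqLanguage

/-! Internal formulas obey a Łoś principle (`forces_iff`). Contexts are finite, so values of all the
variables over `F` amount to one morphism `γ` from `F` to the simple filter of assignments
(`exists_envOf`). An internal formula is forced at `γ` exactly when the assignments that satisfy it
in `Set` form a member of the image filter `pushforward γ`.

Standardness is not internal, and two facts about the constant sheaf suffice for it: constant germs
are standard (`exists_ΔToY_eq_const`), and standard germs are locally constant
(`exists_sieve_const`). By the first, the premise of overspill yields, for each fixed sequence `s`,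
that `φ(e, s)` is true for almost all `e` (`eventually_of_forces_allSt`). By the second, a section
of sequences is hyper as soon as each fixed `z` is eventually an entry of it (`forces_hyper`).

The required sequence is built generically. Over `F` one takes the filter of pairs of a point and a
sequence, based on the conditions "`φ` is true" and "`z` is an entry", for all `z`. A base set
imposes only finitely many conditions of the second kind. A fixed sequence listing those elements
meets them, and by the premise it satisfies `φ` over almost every point, so the projection to `F` is
a cover. On this cover the second coordinate is hyper and satisfies `φ`. Such objects over `F` come
from `exists_extension`. -/

namespace FilterSet

open PartialMap

/-! ### Image filters of morphisms to simple filters -/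

/-- The image filter of a morphism to a simple filter. -/
def pushforward {F : FilterSet.{u}} {T : Type u} (γ : F ⟶ simple.obj T) : Filter T where
  sets := {P | ∀ᶠ x in F.filter, ∃ t ∈ P, (Quotient.out γ).Graph x t}
  univ_sets := by
    filter_upwards [(Quotient.out γ).eventually_graph] with x ⟨t, ht⟩ using ⟨t, trivial, ht⟩
  sets_of_superset := by
    intro P Q hP hPQ
    change ∀ᶠ x in F.filter, _ at hP ⊢
    filter_upwards [hP] with x ⟨t, ht, hx⟩ using ⟨t, hPQ ht, hx⟩
  inter_sets := by
    intro P Q hP hQ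
    change ∀ᶠ x in F.filter, _ at hP hQ ⊢
    filter_upwards [hP, hQ] with x ⟨t, ht, hx⟩ ⟨t', ht', hx'⟩
    obtain rfl := hx.unique hx'
    exact ⟨t, ⟨ht, ht'⟩, hx⟩

/-- The image filter depends only on the germ, so the representative picked by `Quotient.out` may be
replaced by any other. -/
theorem eventually_pushforward_germ {F : FilterSet.{u}} {T : Type u}
    {c : PartialMap F (simple.obj T)} {P : T → Prop} :
    (∀ᶠ t in pushforward (germ c), P t) ↔ ∀ᶠ x in F.filter, ∃ t : T, c.Graph x t ∧ P t := by
  have h := germ_eq_iff.1 (Quotient.out_eq (germ c))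
  constructor
  · intro h'
    filter_upwards [h, h'] with x ⟨t, ht, ht'⟩ ⟨s, hs, hs'⟩
    obtain rfl := ht.unique hs'
    exact ⟨t, ht', hs⟩
  · intro h'
    change ∀ᶠ x in F.filter, _
    filter_upwards [h, h'] with x ⟨t, ht, ht'⟩ ⟨s, hs, hs'⟩
    obtain rfl := ht'.unique hs
    exact ⟨t, hs', ht⟩

/-- Composing with `β` can only make the image filter finer. This is the persistence of forcing
under restriction. -/
theorem eventually_pushforward_comp {F G : FilterSet.{u}} {T : Type u} (β : G ⟶ F)
    {γ : F ⟶ simple.obj T} {P : T → Prop} (h : ∀ᶠ t in pushforward γ, P t) :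
    ∀ᶠ t in pushforward (β ≫ γ), P t := by
  obtain ⟨b, rfl⟩ := exists_germ β
  obtain ⟨c, rfl⟩ := exists_germ γ
  rw [germ_comp]
  rw [eventually_pushforward_germ] at h ⊢
  filter_upwards [b.eventually_comp c, eventually_of (a := b) h] with x ⟨y, z, hy, hz, hc⟩
    ⟨y', hy', t, ht, hP⟩
  obtain rfl := hy.unique hy'
  obtain rfl := hz.unique ht
  exact ⟨z, hc, hP⟩

theorem eventually_pushforward_comp_map {F : FilterSet.{u}} {S T : Type u}
    {γ : F ⟶ simple.obj S} {f : S ⟶ T} {P : T → Prop} :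
    (∀ᶠ t in pushforward (γ ≫ simple.map f), P t) ↔ ∀ᶠ s in pushforward γ, P (f s) := by
  obtain ⟨c, rfl⟩ := exists_germ γ
  obtain ⟨d, hd⟩ := exists_germ (germ c ≫ simple.map f)
  have h := (germ_comp_map_eq_iff f).1 hd.symm
  rw [← hd, eventually_pushforward_germ, eventually_pushforward_germ]
  constructor
  · intro h'
    filter_upwards [h, h'] with x ⟨s, hs, hfs⟩ ⟨t, ht, hP⟩
    obtain rfl := hfs.unique ht
    exact ⟨s, hs, hP⟩
  · intro h'
    filter_upwards [h, h'] with x ⟨s, hs, hfs⟩ ⟨t, ht, hP⟩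
    obtain rfl := hs.unique ht
    exact ⟨_, hfs, hP⟩

theorem comp_map_eq_comp_map_iff {F : FilterSet.{u}} {S T : Type u} {γ : F ⟶ simple.obj S}
    {f g : S ⟶ T} :
    γ ≫ simple.map f = γ ≫ simple.map g ↔ ∀ᶠ s in pushforward γ, f s = g s := by
  obtain ⟨c, rfl⟩ := exists_germ γ
  rw [germ_comp_map_eq_comp_map_iff, eventually_pushforward_germ]
  constructor
  · intro h
    filter_upwards [h] with x ⟨s, s', hs, hs', h⟩
    obtain rfl := hs.unique hs'
    exact ⟨s, hs, h⟩
  · intro h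
    filter_upwards [h] with x ⟨s, hs, h⟩ using ⟨s, s, hs, hs, h⟩

theorem comp_map_eq_const_iff {F : FilterSet.{u}} {S T : Type u} {γ : F ⟶ simple.obj S}
    {f : S ⟶ T} {z : T} :
    γ ≫ simple.map f = const F z ↔ ∀ᶠ s in pushforward γ, f s = z := by
  obtain ⟨c, rfl⟩ := exists_germ γ
  rw [eventually_pushforward_germ]
  refine (germ_comp_map_eq_iff f (b := ofFun (G := simpleObj T) (fun _ => z)
    fun _ => ⟨F.inhabited.some, fun _ _ => trivial⟩)).trans ?_
  have h0 := ofFun_graph (F := F) (G := simpleObj T) (fun _ => z)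
    fun _ => ⟨F.inhabited.some, fun _ _ => trivial⟩
  constructor
  · intro h
    filter_upwards [h] with x ⟨s, hs, hz⟩ using ⟨s, hs, (eq_of_ofFun_graph hz).symm⟩
  · intro h
    filter_upwards [h, h0] with x ⟨s, hs, h⟩ hx
    exact ⟨s, hs, h ▸ hx⟩

/-- The local character of forcing: `P` holds on a large set of each member of a covering family,
and the images of these sets together contain a base set of `F`. -/
theorem eventually_pushforward_of_mem {F : FilterSet.{u}} {T : Type u} {γ : F ⟶ simple.obj T}
    {P : T → Prop} {S : Sieve F} (hS : S ∈ precanonicalTopology F)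
    (h : ∀ (G : FilterSet.{u}) (β : G ⟶ F), S β → ∀ᶠ t in pushforward (β ≫ γ), P t) :
    ∀ᶠ t in pushforward γ, P t := by
  obtain ⟨ι, _, G, β, hβ, hSβ⟩ := hS
  obtain ⟨c, rfl⟩ := exists_germ γ
  choose b hb using fun k => exists_germ (β k)
  obtain rfl : (fun k => germ (b k)) = β := funext hb
  have h := fun k => h _ _ (hSβ k)
  simp only [germ_comp, eventually_pushforward_germ] at h ⊢
  filter_upwards [(isCover_germ_iff _ _).1 hβ _ h] with x ⟨k, z, ⟨t, ht, hP⟩, hzx⟩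
  obtain ⟨x', hx', hxt⟩ := comp_graph ht
  obtain rfl := hx'.unique hzx
  exact ⟨t, hxt, hP⟩

/-! ### Lifts, pairs and covers built by extension -/

/-- A morphism to a simple filter lifts along a function if its image lies in the range. -/
theorem exists_comp_map_eq {F : FilterSet.{u}} {S T : Type u} {γ : F ⟶ simple.obj T}
    {f : S ⟶ T} (h : ∀ᶠ t in pushforward γ, ∃ s, f s = t) :
    ∃ δ : F ⟶ simple.obj S, δ ≫ simple.map f = γ := by
  obtain ⟨c, rfl⟩ := exists_germ γ
  rw [eventually_pushforward_germ] at h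
  by_cases hS : Nonempty S
  · let g : T → S := Function.invFun f
    obtain ⟨d, hd⟩ := exists_ofRel (F := F) (G := simple.obj S)
      (fun x s => ∃ t, c.Graph x t ∧ s = g t)
      (Filter.Eventually.of_forall (by
        rintro x s s' ⟨t, ht, rfl⟩ ⟨t', ht', rfl⟩
        rw [ht.unique ht']))
      (fun _ => by
        filter_upwards [h] with x ⟨t, ht, _⟩
        exact ⟨g t, trivial, t, ht, rfl⟩)
    refine ⟨germ d, (germ_comp_map_eq_iff f).2 ?_⟩
    filter_upwards [h, hd] with x ⟨t, ht, hs⟩ hd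
    refine ⟨g t, hd _ ⟨t, ht, rfl⟩, ?_⟩
    rw [show f (g t) = t from Function.invFun_eq hs]
    exact ht
  -- With `S` empty the hypothesis makes the filter of `F` improper, and then any relation defines a
  -- germ and any two germs agree.
  · have h' : ∀ᶠ x in F.filter, False := by
      filter_upwards [h] with x ⟨t, _, s, _⟩ using hS ⟨s⟩
    obtain ⟨d, -⟩ := exists_ofRel (F := F) (G := simple.obj S) (fun _ _ => True)
      (h'.mono fun _ => False.elim) (fun _ => h'.mono fun _ => False.elim)
    exact ⟨germ d, (germ_comp_map_eq_iff f).2 (h'.mono fun _ => False.elim)⟩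

theorem exists_pair {F : FilterSet.{u}} {S T : Type u} (α : F ⟶ simple.obj S)
    (γ : F ⟶ simple.obj T) : ∃ δ : F ⟶ simple.obj (S × T),
      δ ≫ simple.map (↾Prod.fst) = α ∧ δ ≫ simple.map (↾Prod.snd) = γ := by
  obtain ⟨a, rfl⟩ := exists_germ α
  obtain ⟨c, rfl⟩ := exists_germ γ
  obtain ⟨d, hd⟩ := exists_ofRel (F := F) (G := simple.obj (S × T))
    (fun x (p : S × T) => a.Graph x p.1 ∧ c.Graph x p.2)
    (Filter.Eventually.of_forall fun x p q hp hq =>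
      Prod.ext (hp.1.unique hq.1) (hp.2.unique hq.2))
    (fun _ => by
      filter_upwards [a.eventually_graph, c.eventually_graph] with x ⟨s, hs⟩ ⟨t, ht⟩
      exact ⟨(s, t), trivial, hs, ht⟩)
  have h : ∀ᶠ x in F.filter, ∃ p : S × T, d.Graph x p ∧ a.Graph x p.1 ∧ c.Graph x p.2 := by
    filter_upwards [a.eventually_graph, c.eventually_graph, hd] with x ⟨s, hs⟩ ⟨t, ht⟩ hd
    exact ⟨(s, t), hd _ ⟨hs, ht⟩, hs, ht⟩
  refine ⟨germ d, (germ_comp_map_eq_iff _).2 ?_, (germ_comp_map_eq_iff _).2 ?_⟩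
  · filter_upwards [h] with x ⟨p, hp, h1, _⟩ using ⟨p, hp, h1⟩
  · filter_upwards [h] with x ⟨p, hp, _, h2⟩ using ⟨p, hp, h2⟩

/-- The pullback along `f : W → T` of a morphism to the simple filter of `T`, intersected with a
filter on `W`. -/
def extensionObj {F : FilterSet.{u}} {T W : Type u} (c : PartialMap F (simple.obj T))
    (f : W → T) (B : Filter W) : FilterSet.{u} where
  carrier := F.carrier × W
  Idx := F.Idx × {P : Set W // P ∈ B}
  base i := {x | x.1 ∈ F.base i.1 ∧ x.2 ∈ i.2.1 ∧ c.Graph x.1 (f x.2)}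
  inhabited := F.inhabited.elim fun i => ⟨(i, ⟨Set.univ, Filter.univ_mem⟩)⟩
  directed i j := by
    obtain ⟨k, hk⟩ := F.directed i.1 j.1
    exact ⟨(k, ⟨i.2.1 ∩ j.2.1, Filter.inter_mem i.2.2 j.2.2⟩), fun x hx =>
      ⟨⟨(hk hx.1).1, hx.2.1.1, hx.2.2⟩, (hk hx.1).2, hx.2.1.2, hx.2.2⟩⟩

/-- A generic element of `W k` lying over `γ` and subject to the conditions in `B k`. The members of
the cover for disjunction, the test stages for implication and the universal quantifier, and the
overspill witness are all of this form. The last clause reduces covering to a statement about `T`: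
every choice of sets large for the `B k` must jointly reach almost all `t`. -/
theorem exists_extension {F : FilterSet.{u}} {T : Type u} (γ : F ⟶ simple.obj T) {ι : Type}
    [Finite ι] {W : ι → Type u} (f : ∀ k, W k ⟶ T) (B : ∀ k, Filter (W k)) :
    ∃ (G : ι → FilterSet.{u}) (β : ∀ k, G k ⟶ F) (δ : ∀ k, G k ⟶ simple.obj (W k)),
      (∀ k, δ k ≫ simple.map (f k) = β k ≫ γ) ∧
      (∀ k, pushforward (δ k) = (pushforward γ).comap (f k) ⊓ B k) ∧
      ((∀ P : ∀ k, W k → Prop, (∀ k, ∀ᶠ w in B k, P k w) →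
        ∀ᶠ t in pushforward γ, ∃ k w, P k w ∧ f k w = t) → IsCover G β) := by
  obtain ⟨c, rfl⟩ := exists_germ γ
  let G k := extensionObj c (f k) (B k)
  let b k : PartialMap (G k) F := ofFun Prod.fst fun j =>
    ⟨(j, ⟨Set.univ, Filter.univ_mem⟩), fun _ hx => hx.1⟩
  let d k : PartialMap (G k) (simple.obj (W k)) := ofFun (G := simpleObj (W k)) Prod.snd fun j =>
    ⟨(F.inhabited.some, ⟨Set.univ, Filter.univ_mem⟩), fun _ _ => trivial⟩
  have hb k : ∀ᶠ x in (G k).filter, (b k).Graph x x.1 := ofFun_graph _ _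
  have hd k : ∀ᶠ x in (G k).filter, (d k).Graph x x.2 := ofFun_graph (G := simpleObj (W k)) _ _
  have hc k : ∀ᶠ x in (G k).filter, c.Graph x.1 (f k x.2) :=
    ⟨(F.inhabited.some, ⟨Set.univ, Filter.univ_mem⟩), fun _ hx => hx.2.2⟩
  refine ⟨G, fun k => germ (b k), fun k => germ (d k), fun k => ?_, fun k => ?_, fun h => ?_⟩
  · rw [germ_comp, germ_comp_map_eq_iff]
    filter_upwards [hd k, hb k, hc k, (b k).eventually_comp c] with x hd hb hc ⟨y, z, hy, hz, h⟩
    obtain rfl := hb.unique hy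
    obtain rfl := hc.unique hz
    exact ⟨_, hd, h⟩
  · ext P
    have h1 : P ∈ pushforward (germ (d k)) ↔ ∀ᶠ x in (G k).filter, x.2 ∈ P := by
      refine eventually_pushforward_germ.trans ⟨fun h => ?_, fun h => ?_⟩
      · filter_upwards [h, hd k] with x ⟨t, ht, hP⟩ hx
        exact ht.unique hx ▸ hP
      · filter_upwards [h, hd k] with x h hx using ⟨_, hx, h⟩
    rw [h1]
    constructor
    · rintro ⟨⟨i, Q⟩, h⟩
      -- A base set is determined by a condition on the point and one on `w`. The first passes to
      -- `T` as a condition on `t` stating that the part of its fibre in `Q` lies in `P`.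
      have h2 : ∀ᶠ t in pushforward (germ c), ∀ w ∈ Q.1, f k w = t → w ∈ P := by
        rw [eventually_pushforward_germ]
        filter_upwards [c.eventually_graph, F.eventually_base i] with x ⟨t, ht⟩ hx
        refine ⟨t, ht, fun w hw hwt => ?_⟩
        subst hwt
        exact h (show (x, w) ∈ (G k).base (i, Q) from ⟨hx, hw, ht⟩)
      have h3 : ∀ᶠ w in (pushforward (germ c)).comap (f k), w ∈ Q.1 → w ∈ P :=
        (h2.comap (f k)).mono fun w hw hQ => hw w hQ rfl
      filter_upwards [Filter.mem_inf_of_left h3, Filter.mem_inf_of_right Q.2] with w h h' using h h'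
    · intro h
      obtain ⟨A, ⟨A', hA', hA⟩, Q, hQ, rfl⟩ := Filter.mem_inf_iff.1 h
      obtain ⟨i, hi⟩ := eventually_pushforward_germ.1 (show ∀ᶠ t in _, t ∈ A' from hA')
      refine ⟨(i, ⟨Q, hQ⟩), fun x hx => ⟨hA ?_, hx.2.1⟩⟩
      obtain ⟨t, ht, htA⟩ := hi hx.1
      obtain rfl := ht.unique hx.2.2
      exact htA
  · rw [isCover_germ_iff]
    intro p hp
    choose i hi using fun k => (hp k).and (hb k)
    have h1 := eventually_pushforward_germ.1 (h (fun k w => w ∈ (i k).2.1) fun k => (i k).2.2)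
    -- The finiteness of `ι` enters here: the base sets of `F` chosen for the various `k` have a
    -- common refinement.
    have h2 : ∀ᶠ x in F.filter, ∀ k, x ∈ F.base (i k).1 :=
      Filter.eventually_all.2 fun k => F.eventually_base _
    filter_upwards [h1, h2] with x ⟨t, ht, k, w, hw, hwt⟩ hx
    subst hwt
    have := hi k (show (x, w) ∈ (G k).base (i k) from ⟨hx k, hw, ht⟩)
    exact ⟨k, (x, w), this.1, this.2⟩

/-- The empty family covers `F` exactly when some base set of `F` is empty, that is, when the image
filter is improper. -/
theorem bot_mem_iff {F : FilterSet.{u}} {T : Type u} (γ : F ⟶ simple.obj T) :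
    ⊥ ∈ precanonicalTopology F ↔ ∀ᶠ _ in pushforward γ, False := by
  refine ⟨fun h => eventually_pushforward_of_mem h fun _ _ h => h.elim, fun h => ?_⟩
  obtain ⟨G, β, -, -, -, hβ⟩ := exists_extension γ (ι := Empty) (W := fun _ => T)
    (fun k => k.elim) (fun k => k.elim)
  exact ⟨Empty, inferInstance, G, β, hβ fun _ _ => h.mono fun _ => False.elim, fun k => k.elim⟩

end FilterSet

/-! ### Assignments as morphisms, and truth of internal formulas -/

namespace SeqLanguage

open FilterSet

variable {L : SeqLanguage.{a}} (M : SetStructure.{u} L)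

/-- Assignments of elements to the variables of a context. -/
def SetStructure.Env : List L.Ty → Type u
  | [] => PUnit
  | σ :: Γ => M.sort σ × SetStructure.Env Γ

variable {M}

/-- The value of a variable. -/
def Var.get : ∀ {Γ : List L.Ty} {σ : L.Ty}, Var Γ σ → M.Env Γ → M.sort σ
  | _, _, .zero => fun e => e.1
  | _, _, .succ x => fun e => x.get e.2

/-- The interpretation of terms in `Set`. -/
def Term.realize {Γ : List L.Ty} : ∀ {σ : L.Ty}, L.Term Γ σ → M.Env Γ → M.sort σ
  | _, .var x => x.get
  | _, .app f ts => fun e => M.fn f fun i => (ts i).realize e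

/-- Truth of internal formulas in `Set` (standardness predicates are interpreted as false). -/
def Formula.Realize : ∀ {Γ : List L.Ty}, L.Formula Γ → M.Env Γ → Prop
  | _, .falsum, _ => False
  | _, .eq t s, e => t.realize e = s.realize e
  | _, .rel r ts, e => (fun i => (ts i).realize e) ∈ M.rel r
  | _, .mem (σ := σ) t s, e => t.realize e ∈ M.seqEquiv σ (s.realize e)
  | _, .st _, _ => False
  | _, .and φ ψ, e => φ.Realize e ∧ ψ.Realize e
  | _, .or φ ψ, e => φ.Realize e ∨ ψ.Realize e
  | _, .imp φ ψ, e => φ.Realize e → ψ.Realize e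
  | _, .all σ φ, e => ∀ x : M.sort σ, φ.Realize (x, e)
  | _, .ex σ φ, e => ∃ x : M.sort σ, φ.Realize (x, e)

/-- The assignment of sections over `F` given by a morphism to the set of assignments. -/
noncomputable def envOf {Γ : List L.Ty} {F : FilterSet.{u}} (γ : F ⟶ simple.obj (M.Env Γ)) :
    M.nonstandard.Env Γ F :=
  fun _ x => ULift.up (γ ≫ simple.map (↾x.get))

theorem envOf_comp {Γ : List L.Ty} {F G : FilterSet.{u}} (β : G ⟶ F)
    (γ : F ⟶ simple.obj (M.Env Γ)) : envOf (β ≫ γ) = (envOf γ).restrict β := by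
  funext σ x
  exact congrArg ULift.up (Category.assoc _ _ _)

theorem envOf_cons {Γ : List L.Ty} {σ : L.Ty} {F : FilterSet.{u}}
    (δ : F ⟶ simple.obj (M.Env (σ :: Γ))) :
    envOf δ = (envOf (δ ≫ simple.map (↾fun e : M.Env (σ :: Γ) => (e.2 : M.Env Γ)))).cons
      (ULift.up (δ ≫ simple.map (↾fun e : M.Env (σ :: Γ) => (e.1 : M.sort σ)))) := by
  funext τ x
  cases x with
  | zero => rfl
  | succ x =>
    refine congrArg ULift.up (Eq.trans ?_ (Category.assoc _ _ _).symm)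
    rw [← simple.map_comp]
    rfl

theorem cons_envOf {Γ : List L.Ty} {σ : L.Ty} {F : FilterSet.{u}}
    (x : (M.nonstandard.sort σ).obj.obj (op F)) (γ : F ⟶ simple.obj (M.Env Γ)) :
    ∃ δ : F ⟶ simple.obj (M.Env (σ :: Γ)), (envOf γ).cons x = envOf δ ∧
      δ ≫ simple.map (↾fun e : M.Env (σ :: Γ) => (e.1 : M.sort σ)) = x.down ∧
      δ ≫ simple.map (↾fun e : M.Env (σ :: Γ) => (e.2 : M.Env Γ)) = γ := by
  obtain ⟨δ, h1, h2⟩ := exists_pair (x.down : F ⟶ simple.obj (M.sort σ)) γ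
  refine ⟨δ, ?_, h1, h2⟩
  refine Eq.trans ?_ (envOf_cons (M := M) δ).symm
  change _ = SheafStructure.Env.cons (ULift.up (δ ≫ simple.map (↾Prod.fst)))
    (envOf (δ ≫ simple.map (↾Prod.snd)))
  rw [h1, h2]
  rfl

/-- Pairing the components one at a time along the finite context turns an assignment of sections
into a single germ, so all variables are tested against one filter. -/
theorem exists_envOf : ∀ {Γ : List L.Ty} {F : FilterSet.{u}} (ρ : M.nonstandard.Env Γ F),
    ∃ γ : F ⟶ simple.obj (M.Env Γ), envOf γ = ρ
  | [], F, ρ => ⟨const F PUnit.unit, by funext σ x; cases x⟩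
  | σ :: Γ, F, ρ => by
    obtain ⟨γ, hγ⟩ := exists_envOf fun τ x => ρ τ x.succ
    obtain ⟨δ, hδ, -⟩ := cons_envOf (ρ σ .zero) γ
    refine ⟨δ, hδ.symm.trans ?_⟩
    rw [hγ]
    funext τ x
    cases x <;> rfl

theorem eval_envOf {Γ : List L.Ty} {F : FilterSet.{u}} (γ : F ⟶ simple.obj (M.Env Γ)) :
    ∀ {σ : L.Ty} (t : L.Term Γ σ),
      SheafStructure.eval (envOf γ) t = ULift.up (γ ≫ simple.map (↾t.realize))
  | _, .var x => rfl
  | _, .app f ts => by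
    have ih := funext fun i => eval_envOf γ (ts i)
    refine (congrArg ((yFn (M.fn f)).app (op F)) ih).trans (congrArg ULift.up ?_)
    have h : tuple (fun i => γ ≫ simple.map (↾(ts i).realize)) =
        γ ≫ simple.map (↾fun e i => (ts i).realize e) := tuple_ext fun i => by
      rw [tuple_proj, Category.assoc, ← simple.map_comp]
      rfl
    change tuple (fun i => γ ≫ simple.map (↾(ts i).realize)) ≫ simple.map (↾(M.fn f)) = _
    rw [h, Category.assoc, ← simple.map_comp]
    rfl

/-- The Łoś principle, by induction on the formula. For each connective one direction uses
persistence or locality of image filters, and the other produces a stage on which the subformula is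
generically true or the variable is generic. -/
theorem forces_iff {Γ : List L.Ty} (φ : L.Formula Γ) (hφ : φ.IsInternal) {F : FilterSet.{u}}
    (γ : F ⟶ simple.obj (M.Env Γ)) :
    SheafStructure.Forces φ F (envOf γ) ↔ ∀ᶠ e in pushforward γ, φ.Realize e := by
  induction φ generalizing F with
  | falsum => exact bot_mem_iff γ
  | eq t s =>
    change SheafStructure.eval _ t = SheafStructure.eval _ s ↔ _
    rw [eval_envOf, eval_envOf]
    exact ⟨fun h => comp_map_eq_comp_map_iff.1 (congrArg ULift.down h),
      fun h => congrArg ULift.up (comp_map_eq_comp_map_iff.2 h)⟩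
  | rel r ts =>
    have ih := funext fun i => eval_envOf γ (ts i)
    have h : (fun i => γ ≫ simple.map (↾(ts i).realize)) = fun i =>
        (γ ≫ simple.map (↾fun e i => (ts i).realize e)) ≫ simple.map (↾fun x => x i) := by
      funext i
      rw [Category.assoc, ← simple.map_comp]
      rfl
    have key : (∃ x : F ⟶ simple.obj (M.rel r), x ≫ simple.map (↾Subtype.val) =
        γ ≫ simple.map (↾fun e i => (ts i).realize e)) ↔
        ∀ᶠ e in pushforward γ, (fun i => (ts i).realize e) ∈ M.rel r := by
      constructor
      · rintro ⟨x, hx⟩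
        have := eventually_pushforward_comp_map (γ := x) (f := ↾Subtype.val)
          (P := fun y => y ∈ M.rel r) |>.2 (Filter.Eventually.of_forall fun y => y.2)
        rw [hx, eventually_pushforward_comp_map] at this
        exact this
      · intro h
        refine exists_comp_map_eq ?_
        rw [eventually_pushforward_comp_map]
        filter_upwards [h] with e he using ⟨⟨_, he⟩, rfl⟩
    refine Iff.trans ?_ key
    change (∃ x : ULift _, _ = fun i => SheafStructure.eval _ (ts i)) ↔ _
    rw [ih]
    constructor
    · rintro ⟨x, hx⟩
      refine ⟨x.down, tuple_ext fun i => ?_⟩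
      refine Eq.trans ?_ ((congrArg ULift.down (congrFun hx i)).trans (congrFun h i))
      rw [Category.assoc, ← simple.map_comp]
      rfl
    · rintro ⟨x, hx⟩
      refine ⟨ULift.up x, funext fun i => congrArg ULift.up ?_⟩
      refine Eq.trans ?_ (congrFun h i).symm
      rw [← hx, Category.assoc, ← simple.map_comp]
      rfl
  | @mem Γ σ t s =>
    let R := {p : M.sort σ × M.sort (L.star σ) // p.1 ∈ M.seqEquiv σ p.2}
    change (∃ x : ULift (F ⟶ simple.obj R), _ =
      (SheafStructure.eval (envOf γ) t, SheafStructure.eval (envOf γ) s)) ↔ _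
    rw [eval_envOf, eval_envOf]
    constructor
    · rintro ⟨⟨x⟩, hx⟩
      have h1 : x ≫ simple.map (↾fun p : R => p.1.1) = γ ≫ simple.map (↾t.realize) :=
        congrArg (fun p => ULift.down (Prod.fst p)) hx
      have h2 : x ≫ simple.map (↾fun p : R => p.1.2) = γ ≫ simple.map (↾s.realize) :=
        congrArg (fun p => ULift.down (Prod.snd p)) hx
      -- Pairing `x` with `γ` turns the two equations of germs into conditions on one image filter.
      obtain ⟨δ, rfl, rfl⟩ := exists_pair x γ
      simp only [Category.assoc, ← simple.map_comp] at h1 h2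
      rw [comp_map_eq_comp_map_iff] at h1 h2
      rw [eventually_pushforward_comp_map]
      filter_upwards [h1, h2] with d h1 h2
      have h := d.1.2
      change d.1.1.1 = t.realize d.2 at h1
      change d.1.1.2 = s.realize d.2 at h2
      rw [h1, h2] at h
      exact h
    · intro h
      obtain ⟨x, hx⟩ := exists_comp_map_eq (f := ↾(Subtype.val : R → _))
        (γ := γ ≫ simple.map (↾fun e => (t.realize e, s.realize e))) <| by
          rw [eventually_pushforward_comp_map]
          filter_upwards [h] with e he using ⟨⟨(t.realize e, s.realize e), he⟩, rfl⟩
      refine ⟨ULift.up x, Prod.ext (congrArg ULift.up ?_) (congrArg ULift.up ?_)⟩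
      · have := congrArg (· ≫ simple.map (↾Prod.fst)) hx
        simp only [Category.assoc, ← simple.map_comp] at this
        exact this
      · have := congrArg (· ≫ simple.map (↾Prod.snd)) hx
        simp only [Category.assoc, ← simple.map_comp] at this
        exact this
  | st t => exact hφ.elim
  | and φ ψ ihφ ihψ =>
    exact (and_congr (ihφ hφ.1 γ) (ihψ hφ.2 γ)).trans Filter.eventually_and.symm
  | or φ ψ ihφ ihψ =>
    change (∃ S ∈ precanonicalTopology F, ∀ (V : FilterSet.{u}) (f : V ⟶ F), S f →
      SheafStructure.Forces φ V ((envOf γ).restrict f) ∨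
      SheafStructure.Forces ψ V ((envOf γ).restrict f)) ↔ _
    simp only [← envOf_comp, ihφ hφ.1, ihψ hφ.2]
    constructor
    · rintro ⟨S, hS, h⟩
      refine eventually_pushforward_of_mem hS fun G β hβ => ?_
      rcases h G β hβ with h | h
      · exact h.mono fun _ => Or.inl
      · exact h.mono fun _ => Or.inr
    · intro h
      -- The two restrictions of `F`, to where `φ` is true and to where `ψ` is true, form a cover
      -- because almost every assignment lies in one of the two sets.
      obtain ⟨G, β, δ, hδ, hp, hc⟩ := exists_extension γ (ι := Bool) (fun _ => 𝟙 _)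
        fun k => Filter.principal {e | cond k (φ.Realize e) (ψ.Realize e)}
      have hδ' k : δ k = β k ≫ γ := by simpa using hδ k
      have hk k : ∀ᶠ e in pushforward (β k ≫ γ), cond k (φ.Realize e) (ψ.Realize e) := by
        rw [← hδ', hp]
        exact Filter.mem_inf_of_right (Filter.mem_principal_self _)
      refine ⟨Sieve.generate (Presieve.ofArrows G β),
        ⟨Bool, inferInstance, G, β, hc fun P hP => ?_, fun k =>
          Sieve.le_generate _ _ _ (Presieve.ofArrows.mk k)⟩, ?_⟩
      · filter_upwards [h] with e he
        rcases he with he | he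
        · exact ⟨true, e, hP true he, rfl⟩
        · exact ⟨false, e, hP false he, rfl⟩
      · rintro V _ ⟨_, g, _, ⟨k⟩, rfl⟩
        rw [Category.assoc]
        have := eventually_pushforward_comp g (hk k)
        cases k
        · exact Or.inr this
        · exact Or.inl this
  | imp φ ψ ihφ ihψ =>
    change (∀ (V : FilterSet.{u}) (f : V ⟶ F),
      SheafStructure.Forces φ V ((envOf γ).restrict f) →
      SheafStructure.Forces ψ V ((envOf γ).restrict f)) ↔ _
    simp only [← envOf_comp, ihφ hφ.1, ihψ hφ.2]
    constructor
    · intro h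
      -- It suffices to test the implication at the restriction of `F` to where `φ` is true.
      obtain ⟨G, β, δ, hδ, hp, -⟩ := exists_extension γ (ι := Unit) (fun _ => 𝟙 _)
        fun k => Filter.principal {e | φ.Realize e}
      have hδ' : δ () = β () ≫ γ := by simpa using hδ ()
      have := h _ (β ())
      rw [← hδ', hp] at this
      have := this (Filter.mem_inf_of_right (Filter.mem_principal_self _))
      have := Filter.mem_inf_principal.1 this
      have := Filter.mem_comap.1 this
      obtain ⟨A, hA, hAe⟩ := this
      filter_upwards [hA] with e he using hAe he
    · intro h V f h'
      filter_upwards [h', eventually_pushforward_comp f h] with e h1 h2 using h2 h1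
  | @all Γ σ φ ih =>
    change (∀ (V : FilterSet.{u}) (f : V ⟶ F) (x : _),
      SheafStructure.Forces φ V (((envOf γ).restrict f).cons x)) ↔ _
    simp only [← envOf_comp]
    constructor
    · intro h
      -- The test stage adjoins an unconstrained element `x`; large sets in the comap filter contain
      -- whole fibres, hence all values of `x`.
      obtain ⟨G, β, δ, hδ, hp, -⟩ := exists_extension γ (ι := Unit) (W := fun _ => M.Env (σ :: Γ))
        (fun _ => ↾fun e : M.Env (σ :: Γ) => (e.2 : M.Env Γ)) fun _ => ⊤
      have h := h _ (β ()) (ULift.up (δ () ≫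
        simple.map (↾fun e : M.Env (σ :: Γ) => (e.1 : M.sort σ))))
      rw [← hδ ()] at h
      have h := (ih hφ (δ ())).1 ((envOf_cons (δ ())).symm ▸ h)
      rw [hp, inf_top_eq] at h
      obtain ⟨A, hA, hAe⟩ := Filter.mem_comap.1 h
      filter_upwards [hA] with e he x
      exact hAe (show (x, e) ∈ _ from he)
    · intro h V f x
      obtain ⟨δ, hδ, -, h2⟩ := cons_envOf x (f ≫ γ)
      rw [hδ, ih hφ]
      have := eventually_pushforward_comp f h
      rw [← h2, eventually_pushforward_comp_map] at this
      filter_upwards [this] with e he using he e.1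
  | @ex Γ σ φ ih =>
    change (∃ S ∈ precanonicalTopology F, ∀ (V : FilterSet.{u}) (f : V ⟶ F), S f →
      ∃ x, SheafStructure.Forces φ V (((envOf γ).restrict f).cons x)) ↔ _
    simp only [← envOf_comp]
    constructor
    · rintro ⟨S, hS, h⟩
      refine eventually_pushforward_of_mem hS fun G β hβ => ?_
      obtain ⟨x, hx⟩ := h G β hβ
      obtain ⟨δ, hδ, -, h2⟩ := cons_envOf x (β ≫ γ)
      rw [hδ, ih hφ] at hx
      rw [← h2, eventually_pushforward_comp_map]
      filter_upwards [hx] with e he using ⟨e.1, he⟩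
    · intro h
      let R := {e : M.Env (σ :: Γ) // φ.Realize e}
      -- Choice in `Set` selects witnesses over all of `F` at once, so the maximal sieve serves as
      -- cover.
      obtain ⟨ε, hε⟩ := exists_comp_map_eq (S := R) (f := ↾fun e : R => (e.1.2 : M.Env Γ))
        (h.mono fun e ⟨x, hx⟩ => ⟨⟨(x, e), hx⟩, rfl⟩)
      refine ⟨⊤, GrothendieckTopology.top_mem _ _, fun V f _ => ?_⟩
      let δ := f ≫ ε ≫ simple.map (↾(Subtype.val : R → M.Env (σ :: Γ)))
      have hδ : δ ≫ simple.map (↾fun e : M.Env (σ :: Γ) => (e.2 : M.Env Γ)) = f ≫ γ := by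
        rw [← hε]
        simp only [δ, Category.assoc, ← simple.map_comp]
        rfl
      refine ⟨ULift.up (δ ≫ simple.map (↾fun e : M.Env (σ :: Γ) => (e.1 : M.sort σ))), ?_⟩
      rw [← hδ]
      refine (envOf_cons δ) ▸ (ih hφ δ).2 ?_
      refine eventually_pushforward_comp f (eventually_pushforward_comp_map.2 ?_)
      exact Filter.Eventually.of_forall fun e => e.2

end SeqLanguage

/-! ### Standard sections: the constant sheaf inside `yS` -/

namespace FilterSet

theorem unit_comp_ΔToY (S : Type u) :
    toSheafify precanonicalTopology.{u} _ ≫ (ΔToY S).hom = constToY S := by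
  have := ((sheafificationAdjunction precanonicalTopology.{u} (Type (u + 1))).homEquiv
    ((Functor.const FilterSet.{u}ᵒᵖ).obj (ULift.{u + 1} S)) (y.obj S)).apply_symm_apply
      (constToY S)
  rwa [Adjunction.homEquiv_unit] at this

theorem exists_ΔToY_eq_const {S : Type u} (F : FilterSet.{u}) (z : S) :
    ∃ x, (ΔToY S).hom.app (op F) x = ULift.up (const F z) :=
  ⟨(toSheafify precanonicalTopology.{u} ((Functor.const _).obj (ULift.{u + 1} S))).app (op F)
      (ULift.up z),
    types_congr_hom (congrArg (fun f => f.app (op F)) (unit_comp_ΔToY S)) (ULift.up z)⟩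

/-- Sections of the constant sheaf are locally constant. -/
theorem exists_sieve_const {S : Type u} {F : FilterSet.{u}} (x : (Δ S).obj.obj (op F)) :
    ∃ T ∈ precanonicalTopology F, ∀ (G : FilterSet.{u}) (β : G ⟶ F), T β →
      ∃ z : S, (y.obj S).obj.map β.op ((ΔToY S).hom.app (op F) x) = ULift.up (const G z) := by
  -- The unit of sheafification is locally surjective, so `x` locally comes from an element of the
  -- constant presheaf.
  have h := Presheaf.imageSieve_mem precanonicalTopology.{u}
    (toSheafify precanonicalTopology.{u} ((Functor.const _).obj (ULift.{u + 1} S))) x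
  refine ⟨_, h, fun G β ⟨z, hz⟩ => ⟨z.down, ?_⟩⟩
  refine ((ΔToY S).hom.naturality_apply β.op x).symm.trans ?_
  refine (congrArg ((ΔToY S).hom.app (op G)) hz).symm.trans ?_
  exact types_congr_hom (congrArg (fun f => f.app (op G)) (unit_comp_ΔToY S)) z

end FilterSet

/-! ### Standard quantifiers and hyper sequences -/

namespace SeqLanguage

open FilterSet

variable {L : SeqLanguage.{a}} {M : SetStructure.{u} L}

/-- The constant germ at `z` is standard already over `F`, so the quantifier can be instantiated
there and the result read through `forces_iff`. -/
theorem eventually_of_forces_allSt {Γ : List L.Ty} {σ : L.Ty} {φ : L.Formula (σ :: Γ)}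
    (hφ : φ.IsInternal) {F : FilterSet.{u}} {γ : F ⟶ simple.obj (M.Env Γ)}
    (h : SheafStructure.Forces (.allSt σ φ) F (envOf γ)) (z : M.sort σ) :
    ∀ᶠ e in pushforward γ, φ.Realize (z, e) := by
  have h := h F (𝟙 F) (ULift.up (const F z)) F (𝟙 F)
  rw [← envOf_comp, Category.id_comp] at h
  obtain ⟨δ, hδ, h1, h2⟩ := cons_envOf (M := M) (σ := σ) (ULift.up (const F z)) γ
  rw [hδ, ← envOf_comp, Category.id_comp, forces_iff _ hφ] at h
  have h := h (by
    obtain ⟨x, hx⟩ := exists_ΔToY_eq_const F z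
    exact ⟨x, hx.trans (congrArg ULift.up h1.symm)⟩)
  rw [← h2, eventually_pushforward_comp_map]
  filter_upwards [h, comp_map_eq_const_iff.1 h1] with e he hz
  obtain ⟨e1, e2⟩ := e
  obtain rfl : e1 = z := hz
  exact he

/-- A standard element is locally a constant `z`, and membership of a fixed `z` is what `h`
supplies. The large set may depend on `z`; no uniformity is needed. -/
theorem forces_hyper {Γ : List L.Ty} {σ : L.Ty} {F : FilterSet.{u}}
    {γ : F ⟶ simple.obj (M.Env (L.star σ :: Γ))}
    (h : ∀ z : M.sort σ, ∀ᶠ e in pushforward γ, z ∈ M.seqEquiv σ e.1) :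
    SheafStructure.Forces (.hyper (.var .zero)) F (envOf γ) := by
  intro G β x H η hst
  rw [← envOf_comp] at hst ⊢
  obtain ⟨δ, hδ, h1, h2⟩ := cons_envOf x (β ≫ γ)
  rw [hδ, ← envOf_comp] at hst ⊢
  obtain ⟨w, hw⟩ := hst
  obtain ⟨T, hT, hTw⟩ := exists_sieve_const w
  -- Membership is internal, so it may be checked on the sieve where `w` is constant.
  refine (forces_iff _ (by trivial) _).2 (eventually_pushforward_of_mem hT fun K κ hκ => ?_)
  obtain ⟨z, hz⟩ := hTw K κ hκ
  have hw : (ΔToY (M.sort σ)).hom.app (op H) w = ULift.up ((η ≫ δ) ≫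
    simple.map (↾fun e : M.Env (σ :: L.star σ :: Γ) => (e.1 : M.sort σ))) := hw
  rw [hw] at hz
  have hz : (κ ≫ η ≫ δ) ≫ simple.map (↾fun e : M.Env (σ :: L.star σ :: Γ) => (e.1 : M.sort σ)) =
    const K z := (Category.assoc _ _ _).trans (congrArg ULift.down hz)
  have h3 := eventually_pushforward_comp β (h z)
  rw [← h2, eventually_pushforward_comp_map] at h3
  filter_upwards [comp_map_eq_const_iff.1 hz,
    eventually_pushforward_comp κ (eventually_pushforward_comp η h3)] with e hz he
  obtain ⟨e1, e2⟩ := e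
  obtain rfl : e1 = z := hz
  exact he

end SeqLanguage

/-! ### Sequence overspill -/

open FilterSet SeqLanguage in
theorem mainTheorem4 {L : SeqLanguage.{a}} (M : SeqLanguage.SetStructure.{u} L)
    {Γ : List L.Ty} (σ : L.Ty) (φ : L.Formula (L.star σ :: Γ)) (hφ : φ.IsInternal) :
    M.nonstandard.Holds (SeqLanguage.Formula.sequenceOverspill σ φ) := by
  intro F ρ V f h
  obtain ⟨γ, rfl⟩ := exists_envOf ρ
  rw [← envOf_comp] at h ⊢
  have hst := eventually_of_forces_allSt hφ h
  -- The conditions defining the generic witness; the parameters remain in the second coordinate,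
  -- tied to `f ≫ γ` by the extension.
  let B : Filter (M.Env (L.star σ :: Γ)) :=
    (⨅ z : M.sort σ, Filter.principal {e | z ∈ M.seqEquiv σ e.1}) ⊓
      Filter.principal {e | φ.Realize e}
  have hB (z : M.sort σ) : ∀ᶠ e in B, z ∈ M.seqEquiv σ e.1 :=
    Filter.mem_inf_of_left (Filter.mem_iInf_of_mem z (Filter.mem_principal_self _))
  have hBφ : ∀ᶠ e in B, φ.Realize e := Filter.mem_inf_of_right (Filter.mem_principal_self _)
  obtain ⟨G, β, δ, hδ, hp, hc⟩ := exists_extension (f ≫ γ) (ι := Unit)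
    (W := fun _ => M.Env (L.star σ :: Γ))
    (fun _ => ↾fun e : M.Env (L.star σ :: Γ) => (e.2 : M.Env Γ)) fun _ => B
  have hle : pushforward (δ ()) ≤ B := by rw [hp]; exact inf_le_right
  refine ⟨Sieve.generate (Presieve.ofArrows G β), ⟨Unit, inferInstance, G, β, hc fun P hP => ?_,
    fun k => Sieve.le_generate _ _ _ (Presieve.ofArrows.mk k)⟩, ?_⟩
  · have hP := hP ()
    obtain ⟨A, hA, C, hC, hAC⟩ := Filter.mem_inf_iff.1 hP
    obtain ⟨t, ht, htA⟩ := (Filter.hasBasis_iInf_principal_finite _).mem_iff.1 hA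
    -- A set large for the infimum requires only the finitely many entries in `t`. The sequence
    -- listing `t` does not depend on `e`, so `hst` applies to it.
    let s : M.sort (L.star σ) := (M.seqEquiv σ).symm ht.toFinset.toList
    filter_upwards [hst s] with e he
    refine ⟨(), (s, e), ?_, rfl⟩
    have hs : (s, e) ∈ A ∩ C :=
      ⟨htA (Set.mem_iInter₂.2 fun z hz => by
        change z ∈ M.seqEquiv σ s
        simpa [s] using hz), hC he⟩
    rwa [← hAC] at hs
  · rintro K _ ⟨_, g, _, ⟨⟨⟩⟩, rfl⟩
    -- The witness is the sequence coordinate of the generic section, restricted along `g`.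
    refine ⟨ULift.up ((g ≫ δ ()) ≫
      simple.map (↾fun e : M.Env (L.star σ :: Γ) => (e.1 : M.sort (L.star σ)))), ?_⟩
    have hg : (g ≫ δ ()) ≫ simple.map (↾fun e : M.Env (L.star σ :: Γ) => (e.2 : M.Env Γ)) =
        (g ≫ β ()) ≫ f ≫ γ := by
      rw [Category.assoc, Category.assoc]
      exact congrArg (g ≫ ·) (hδ ())
    rw [← envOf_comp]
    refine (congrArg envOf hg) ▸ (envOf_cons (g ≫ δ ())) ▸ ⟨forces_hyper fun z => ?_, ?_⟩
    · exact eventually_pushforward_comp g (hle (hB z))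
    · exact (forces_iff φ hφ _).2 (eventually_pushforward_comp g (hle hBφ))
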